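/- Let $A$ and $W$ be finite non-empty sets, $p:W\to\mathbb R$ known weights, and $\lambda:A\times W\to[0,\infty)$ known noise variances. Let $\mathcal H$ be the set of pairs $s=(\mu,\Sigma)$ of a function $\mu$ on $A\times W$ and a positive semidefinite kernel $\Sigma$ on $(A\times W)\times(A\times W)$. Given $s\in\mathcal H$, let $F\sim GP(s)$ on $A\times W$ (the hyperparameters are known, i.e. their prior is concentrated on a single value), let $\varepsilon_0,\varepsilon_1,\dots$ be i.i.d. standard normal and independent of $F$, and put $G(x)=\sum_{w\in W}F(x,w)p(w)$. Evaluating $F$ at $u$ at stage $n$ gives the observation $y_n=F(u)+\sqrt{\lambda_u}\,\varepsilon_n$. After observing $y$ at $u$, the parameters $(\mu,\Sigma)$ are updated to the posterior parameters $$\mu'(v)=\mu(v)+\frac{\Sigma(v,u)}{\Sigma(u,u)+\lambda_u}\,(y-\mu(u)),\qquad \Sigma'(v,v')=\Sigma(v,v')-\frac{\Sigma(v,u)\Sigma(v',u)}{\Sigma(u,u)+\lambda_u}$$ (no change if $\Sigma(u,u)+\lambda_u=0$); $S^0=s,S^1,S^2,\dots$ denote the successive parameters. A policy $\pi$ is a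 sequence of measurable maps $\pi_n$, $n\ge 0$, from parameters to $A\times W$; under $\pi$, stage $n$ evaluates $F$ at $\pi_n(S^n)$. Let $a_N(x)=E[G(x)\mid\mathcal F^N]$, where $\mathcal F^N$ is generated by the points and observations of the first $N$ stages, and set $$V^{\pi,0}(s;N)=E^{\pi}\Big[\max_{x\in A}a_N(x)\,\Big|\,S^0=s\Big],\qquad V^0(s;N)=\sup_{\pi}V^{\pi,0}(s;N).$$ A BQO policy is a policy which in every state $s=(\mu,\Sigma)\in\mathcal H$ and at every stage selects a point $u$ that maximizes the value of information, i.e. the expected increase of $\max_{x}\sum_w\mu(x,w)p(w)$ when $F\sim GP(s)$ and the parameters are updated with one observation at $u$ (ties are broken in any measurable way). Then for every $s\in\mathcal H$ and every BQO policy, $$\lim_{N\to\infty}E^{BQO}\Big[\max_{x\in A}a_N(x)\,\Big|\,S^0=s\Big]=E\Big[\max_{x\in A}G(x)\,\Big|\,S^0=s\Big]$$ and $$\lim_{N\to\infty}V^0(s;N)=\lim_{N\to\infty}V^{BQO,0}(s;N).$$ -/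

import Mathlib

open MeasureTheory ProbabilityTheory Filter Topology

noncomputable section

namespace BQO

/-- Parameters `(μ, Σ)` of a Gaussian process on the finite domain `A × W`. -/
abbrev State (A W : Type*) := (A × W → ℝ) × (A × W → A × W → ℝ)

/-- The set `𝓗` of admissible parameters: arbitrary mean function, positive semidefinite kernel. -/
def IsGP {A W : Type*} [Fintype A] [Fintype W] (s : State A W) : Prop :=
  (Matrix.of s.2).PosSemidef

/-- The sample space: an outcome is a realization of the function `F` on `A × W`
together with a realization of the normalized noise sequence. -/
abbrev Outcome (A W : Type*) := EuclideanSpace ℝ (A × W) × (ℕ → ℝ)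

/-- The law of `(F, ε)`: `F ∼ GP(s)`, and `ε₀, ε₁, …` are i.i.d. standard normal,
independent of `F`. -/
def law {A W : Type*} [Fintype A] [Fintype W] [DecidableEq A] [DecidableEq W]
    (s : State A W) : Measure (Outcome A W) :=
  (multivariateGaussian (WithLp.toLp 2 s.1) (Matrix.of s.2)).prod
    (Measure.infinitePi fun _ : ℕ => gaussianReal 0 1)

/-- The objective `G x = ∑ w, F (x, w) p(w)`. -/
def objective {A W : Type*} [Fintype W] (p : W → ℝ) (x : A) (ω : Outcome A W) : ℝ :=
  ∑ w, ω.1 (x, w) * p w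

/-- The noisy observation of `F` at the point `u` made at stage `n`;
the noise is normal with mean `0` and variance `lam u`. -/
def obs {A W : Type*} (lam : A × W → ℝ) (n : ℕ) (u : A × W) (ω : Outcome A W) : ℝ :=
  ω.1 u + √(lam u) * ω.2 n

/-- The posterior parameters of a Gaussian process with parameters `s`, after the value `y` has been
observed at `u` with noise variance `lam u`. If `Σ(u, u) + lam u = 0`, the observation carries no
information, `Σ(·, u)` vanishes, and the parameters do not change (division by zero gives zero). -/
def update {A W : Type*} (lam : A × W → ℝ) (s : State A W) (u : A × W) (y : ℝ) : State A W :=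
  (fun v => s.1 v + s.2 v u / (s.2 u u + lam u) * (y - s.1 u),
   fun v v' => s.2 v v' - s.2 v u * s.2 v' u / (s.2 u u + lam u))

/-- The mean of `G x` under `GP(s)`. -/
def meanG {A W : Type*} [Fintype W] (p : W → ℝ) (s : State A W) (x : A) : ℝ :=
  ∑ w, s.1 (x, w) * p w

/-- The value of information of an evaluation at `u` in state `s`: the expected increase of the
maximal posterior mean of `G`, when `F ∼ GP(s)` and one noisy observation is made at `u`. -/
def voi {A W : Type*} [Fintype A] [Fintype W] [DecidableEq A] [DecidableEq W]
    (p : W → ℝ) (lam : A × W → ℝ) (s : State A W) (u : A × W) : ℝ :=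
  ∫ ω, ((⨆ x, meanG p (update lam s u (obs lam 0 u ω)) x) - ⨆ x, meanG p s x) ∂(law s)

/-- A policy: a sequence of measurable maps from Gaussian process parameters to the domain of `F`.
With a budget of `N` evaluations only the first `N` maps matter. -/
structure Policy (A W : Type*) where
  /-- the point that is evaluated at stage `n` in the state `s` -/
  act : ℕ → State A W → A × W
  measurableSet_act : ∀ n u, MeasurableSet {s | act n s = u}

/-- A BQO policy: at every stage and in every state, the chosen point maximizes the value of
information. Ties may be broken in any measurable way. -/
def Policy.IsBQO {A W : Type*} [Fintype A] [Fintype W] [DecidableEq A] [DecidableEq W]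
    (p : W → ℝ) (lam : A × W → ℝ) (π : Policy A W) : Prop :=
  ∀ n s, IsGP s → ∀ u, voi p lam s u ≤ voi p lam s (π.act n s)

/-- The state `Sⁿ` (posterior parameters after `n` evaluations), when the policy `π`
is followed from the prior parameters `s`. -/
def stateAt {A W : Type*} (lam : A × W → ℝ) (π : Policy A W) (s : State A W) :
    ℕ → Outcome A W → State A W
  | 0, _ => s
  | n + 1, ω =>
    update lam (stateAt lam π s n ω) (π.act n (stateAt lam π s n ω))
      (obs lam n (π.act n (stateAt lam π s n ω)) ω)

/-- The point evaluated at stage `n`. -/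
def pointAt {A W : Type*} (lam : A × W → ℝ) (π : Policy A W) (s : State A W) (n : ℕ)
    (ω : Outcome A W) : A × W :=
  π.act n (stateAt lam π s n ω)

/-- The observation made at stage `n`. -/
def obsAt {A W : Type*} (lam : A × W → ℝ) (π : Policy A W) (s : State A W) (n : ℕ)
    (ω : Outcome A W) : ℝ :=
  obs lam n (pointAt lam π s n ω) ω

/-- The sigma-algebra generated by the history of the first `n` evaluations
(the points and the observed values). -/
abbrev history {A W : Type*} (lam : A × W → ℝ) (π : Policy A W) (s : State A W) (n : ℕ) :
    MeasurableSpace (Outcome A W) :=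
  ⨆ i : Fin n, (MeasurableSpace.comap (pointAt lam π s i) ⊤ ⊔
    MeasurableSpace.comap (obsAt lam π s i) inferInstance)

/-- The posterior mean `a_n x = E[G x ∣ history of the first n evaluations]`. -/
def postMean {A W : Type*} [Fintype A] [Fintype W] [DecidableEq A] [DecidableEq W]
    (p : W → ℝ) (lam : A × W → ℝ) (π : Policy A W) (s : State A W) (n : ℕ) (x : A) :
    Outcome A W → ℝ :=
  (law s)[objective p x | history lam π s n]

/-- The value `V^{π,0}(s; N) = E^π[max_x a_N x ∣ S⁰ = s]` of a policy. -/
def value {A W : Type*} [Fintype A] [Fintype W] [DecidableEq A] [DecidableEq W]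
    (p : W → ℝ) (lam : A × W → ℝ) (π : Policy A W) (s : State A W) (N : ℕ) : ℝ :=
  ∫ ω, (⨆ x, postMean p lam π s N x ω) ∂(law s)

/-- The optimal value `V⁰(s; N)`: the supremum of the values of all policies
(taken in the extended reals, where it always exists). -/
def optValue {A W : Type*} [Fintype A] [Fintype W] [DecidableEq A] [DecidableEq W]
    (p : W → ℝ) (lam : A × W → ℝ) (s : State A W) (N : ℕ) : EReal :=
  ⨆ π : Policy A W, (value p lam π s N : EReal)

/-- The expected value `E[max_x G x]` under `F ∼ GP(s)`. -/
def expMaxObjective {A W : Type*} [Fintype A] [Fintype W] [DecidableEq A] [DecidableEq W]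
    (p : W → ℝ) (s : State A W) : ℝ :=
  ∫ ω, (⨆ x, objective p x ω) ∂(law s)

end BQO

end

/-!
A BQO policy learns everything about the objective that matters for its maximization, and no policy
can achieve more than full information allows.

*Posteriors.* Along a *fixed* sequence of points (`openLoop`), the residual `F - μₙ` is a centered
Gaussian vector which is independent of the observations, and its covariance kernel is the
deterministic kernel of the state (`openLoop_residual`, by induction with the one-step regression
`gaussian_residual`). A policy that adapts to the observations follows one of finitely many paths
of length `n`. On the event that a given path is followed, its history carries the same information
as the history of the open-loop policy along this path. Hence the mean function of the state is the
posterior mean of `F` (`condExp_process`), and the expected quadratic form of the kernel is the mean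
square error of the posterior mean (`lintegral_residual_sq`), for every policy.

*Pathwise convergence.* Almost surely the posterior means converge, by Lévy's upward theorem. The
kernels decrease in the order of quadratic forms, so they converge as well. The value of information
is the expected gain of the maximum of the lines `z ↦ E[G x] + c x * z` over a standard normal `z`
(`voi_eq_gain`), which is continuous in the coefficients. Some point `v₀` is evaluated infinitely
often. The variance there tends to zero, and so does its value of information. At the times at which
`v₀` is chosen, it maximizes the value of information, so in the limiting state the value of
information vanishes at every point `v` of positive variance. A maximum of lines without expected
gain consists of parallel lines (`slopes_eq_of_gain_nonpos`), that is, `G x - G x'` is uncorrelated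
with `F v` in the limiting state. Therefore the posterior variance of `G x - G x'` tends to zero
(`tendsto_quad_contrast_zero`).

*Values.* The loss of a policy against `E[max G]` is at most the sum over `x` of the `L¹` errors of
the posterior means of `G x - G x₀` (`abs_value_sub_expMaxObjective_le`), because the error of the
posterior mean of `G x₀` itself has expectation zero. These errors tend to zero by dominated
convergence. Conversely, Jensen's inequality gives `V^π ≤ E[max G]` for every policy (`value_le`),
so that the optimal value is squeezed between the value of the BQO policy and `E[max G]`.
-/

noncomputable section

namespace BQO

/-! ### Quadratic forms of kernels and the posterior update -/

/-- The quadratic form `f ↦ ∑ v v', f v K(v, v') f v'` of a kernel on a finite set. If `K` is the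
covariance kernel of `F`, this is the variance of `∑ v, f v F(v)`. -/
def quad {ι : Type*} [Fintype ι] (K : ι → ι → ℝ) (f : ι → ℝ) : ℝ :=
  ∑ v, ∑ v', f v * K v v' * f v'

lemma quad_add_single {ι : Type*} [Fintype ι] [DecidableEq ι] {K : ι → ι → ℝ}
    (hK : ∀ v v', K v v' = K v' v) (f : ι → ℝ) (u : ι) (r : ℝ) :
    quad K (f + Pi.single u r) = quad K f + 2 * r * (∑ v, f v * K v u) + r ^ 2 * K u u := by
  have h1 : ∀ v, (∑ v', (f + Pi.single u r : ι → ℝ) v * K v v' * (f + Pi.single u r : ι → ℝ) v')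
      = (∑ v', f v * K v v' * f v') + f v * K v u * r
        + (Pi.single u r : ι → ℝ) v * (∑ v', K v v' * f v')
        + (Pi.single u r : ι → ℝ) v * (K v u * r) := by
    intro v
    have : f v * K v u * r = ∑ v', f v * K v v' * (Pi.single u r : ι → ℝ) v' := by
      simp [Pi.single_apply]
    rw [this]
    have : K v u * r = ∑ v', K v v' * (Pi.single u r : ι → ℝ) v' := by
      simp [Pi.single_apply]
    rw [this, Finset.mul_sum, Finset.mul_sum, ← Finset.sum_add_distrib, ← Finset.sum_add_distrib,
      ← Finset.sum_add_distrib]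
    exact Finset.sum_congr rfl fun v' _ => by simp only [Pi.add_apply]; ring
  unfold quad
  rw [Finset.sum_congr rfl fun v _ => h1 v]
  simp only [Finset.sum_add_distrib]
  have h2 : ∀ g : ι → ℝ, ∑ v, (Pi.single u r : ι → ℝ) v * g v = r * g u := by
    intro g; simp [Pi.single_apply]
  have h3 : ∑ v', K u v' * f v' = ∑ v, f v * K v u :=
    Finset.sum_congr rfl fun v' _ => by rw [hK u v', mul_comm]
  rw [h2, h2, ← Finset.sum_mul, h3]
  ring

lemma quad_single {ι : Type*} [Fintype ι] [DecidableEq ι] (K : ι → ι → ℝ) (u : ι) (r : ℝ) :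
    quad K (Pi.single u r) = r ^ 2 * K u u := by
  unfold quad
  rw [Finset.sum_eq_single u (fun v _ hv => by simp [hv]) (by simp),
    Finset.sum_eq_single u (fun v _ hv => by simp [hv]) (by simp)]
  simp only [Pi.single_eq_same]; ring

lemma quad_eq_zero_of_forall {ι : Type*} [Fintype ι] {K : ι → ι → ℝ} {f : ι → ℝ}
    (h : ∀ u, ∑ v, f v * K v u = 0) : quad K f = 0 := by
  unfold quad
  rw [Finset.sum_comm]
  exact Finset.sum_eq_zero fun u _ => by rw [← Finset.sum_mul, h, zero_mul]

lemma tendsto_quad {ι : Type*} [Fintype ι] {K : ℕ → ι → ι → ℝ} {T : ι → ι → ℝ}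
    (h : ∀ v v', Tendsto (fun n => K n v v') atTop (𝓝 (T v v'))) (f : ι → ℝ) :
    Tendsto (fun n => quad (K n) f) atTop (𝓝 (quad T f)) :=
  tendsto_finsetSum _ fun v _ => tendsto_finsetSum _ fun v' _ =>
    ((h v v').const_mul (f v)).mul_const (f v')

section

variable {A W : Type*} [Fintype A] [Fintype W]

lemma isGP_iff (s : State A W) :
    IsGP s ↔ (∀ v v', s.2 v v' = s.2 v' v) ∧ ∀ f, 0 ≤ quad s.2 f := by
  have hq : ∀ f : A × W → ℝ, quad s.2 f = star f ⬝ᵥ (Matrix.of s.2).mulVec f := by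
    intro f
    simp only [quad, dotProduct, Matrix.mulVec, Matrix.of_apply, star_trivial, Finset.mul_sum,
      mul_assoc]
  rw [IsGP, Matrix.posSemidef_iff_dotProduct_mulVec]
  refine and_congr ⟨fun h v v' => ?_, fun h => ?_⟩ (forall_congr' fun f => by rw [hq])
  · simpa using (h.apply v v').symm
  · ext v v'
    simpa using h v' v

lemma IsGP.symm {s : State A W} (hs : IsGP s) (v v' : A × W) : s.2 v v' = s.2 v' v :=
  ((isGP_iff s).1 hs).1 v v'

lemma IsGP.quad_nonneg {s : State A W} (hs : IsGP s) (f : A × W → ℝ) : 0 ≤ quad s.2 f :=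
  ((isGP_iff s).1 hs).2 f

/-- An observation at `u` reduces the variance of `∑ v, f v F(v)` by the part that it explains. -/
lemma quad_update (lam : A × W → ℝ) (s : State A W) (u : A × W) (y : ℝ) (f : A × W → ℝ) :
    quad (update lam s u y).2 f
      = quad s.2 f - (∑ v, f v * s.2 v u) ^ 2 / (s.2 u u + lam u) := by
  have : (∑ v, f v * s.2 v u) ^ 2 / (s.2 u u + lam u)
      = ∑ v, ∑ v', f v * (s.2 v u * s.2 v' u / (s.2 u u + lam u)) * f v' := by
    rw [sq, Finset.sum_mul_sum, Finset.sum_div]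
    refine Finset.sum_congr rfl fun v _ => ?_
    rw [Finset.sum_div]
    exact Finset.sum_congr rfl fun v' _ => by ring
  rw [this]
  simp only [quad, update, ← Finset.sum_sub_distrib]
  exact Finset.sum_congr rfl fun v _ => Finset.sum_congr rfl fun v' _ => by ring

variable [DecidableEq A] [DecidableEq W]

lemma IsGP.diag_nonneg {s : State A W} (hs : IsGP s) (u : A × W) : 0 ≤ s.2 u u := by
  simpa [quad_single] using hs.quad_nonneg (Pi.single u 1)

/-- A variable of variance zero is uncorrelated with every other one. -/
lemma IsGP.eq_zero_of_diag_eq_zero {s : State A W} (hs : IsGP s) {u : A × W} (hu : s.2 u u = 0)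
    (v : A × W) : s.2 v u = 0 := by
  have key : ∀ r : ℝ, 0 ≤ s.2 v v + 2 * r * s.2 v u := by
    intro r
    have h := hs.quad_nonneg (Pi.single v 1 + Pi.single u r)
    rw [quad_add_single hs.symm, quad_single, hu] at h
    simpa [Pi.single_apply] using h
  by_contra hne
  have h := key (-(s.2 v v + 1) / (2 * s.2 v u))
  have : 2 * (-(s.2 v v + 1) / (2 * s.2 v u)) * s.2 v u = -(s.2 v v + 1) := by field_simp
  linarith

lemma IsGP.update {lam : A × W → ℝ} (hlam : ∀ u, 0 ≤ lam u) {s : State A W} (hs : IsGP s)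
    (u : A × W) (y : ℝ) : IsGP (update lam s u y) := by
  refine (isGP_iff _).2 ⟨fun v v' => ?_, fun f => ?_⟩
  · simp only [BQO.update, hs.symm v v']; ring
  rw [quad_update]
  have hu := hs.diag_nonneg u
  have hl := hlam u
  set b := ∑ v, f v * s.2 v u
  rcases (add_nonneg hu hl).eq_or_lt with hd | hd
  · rw [← hd, div_zero, sub_zero]; exact hs.quad_nonneg f
  -- the value of the form at `f - (b / d) e_u`, where `d = Σ(u, u) + lam u`
  have h := hs.quad_nonneg (f + Pi.single u (-(b / (s.2 u u + lam u))))
  rw [quad_add_single hs.symm] at h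
  set d := s.2 u u + lam u
  have h1 : (-(b / d)) ^ 2 * s.2 u u ≤ (-(b / d)) ^ 2 * d :=
    mul_le_mul_of_nonneg_left (by simp only [d]; linarith) (sq_nonneg _)
  have h2 : (-(b / d)) ^ 2 * d = b ^ 2 / d := by field_simp
  have h3 : 2 * -(b / d) * b = - 2 * (b ^ 2 / d) := by ring
  change 0 ≤ quad s.2 f + 2 * -(b / d) * b + (-(b / d)) ^ 2 * s.2 u u at h
  linarith

end

/-! ### The expected gain of a maximum of random lines -/

/-- The expected increase of the maximum of the lines `z ↦ a x + c x * z`, when `z` moves from `0`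
to a standard normal random position. -/
def gain {A : Type*} (a c : A → ℝ) : ℝ :=
  ∫ z, ((⨆ x, (a x + c x * z)) - ⨆ x, a x) ∂(gaussianReal 0 1)

lemma gain_zero {A : Type*} (a : A → ℝ) : gain a 0 = 0 := by simp [gain]

lemma integrable_id_gaussianReal : Integrable (fun z : ℝ => z) (gaussianReal 0 1) :=
  IsGaussian.integrable_id

lemma measurable_iSup_line {A : Type*} [Finite A] (a c : A → ℝ) :
    Measurable fun z : ℝ => ⨆ x, (a x + c x * z) :=
  Measurable.iSup fun x => by fun_prop

section

variable {A : Type*} [Fintype A] [Nonempty A]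

lemma abs_iSup_sub_iSup_le (f g : A → ℝ) : |(⨆ x, f x) - ⨆ x, g x| ≤ ∑ x, |f x - g x| := by
  have key : ∀ f g : A → ℝ, (⨆ x, f x) - ⨆ x, g x ≤ ∑ x, |f x - g x| := by
    intro f g
    rw [sub_le_iff_le_add]
    refine ciSup_le fun x => ?_
    have h1 : f x - g x ≤ ∑ x, |f x - g x| := (le_abs_self _).trans
      (Finset.single_le_sum (f := fun x => |f x - g x|) (fun _ _ => abs_nonneg _)
        (Finset.mem_univ x))
    have h2 : g x ≤ ⨆ x, g x := le_ciSup (Set.finite_range g).bddAbove x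
    linarith
  refine abs_le.2 ⟨?_, key f g⟩
  have := key g f
  simp only [abs_sub_comm (g _)] at this
  linarith

lemma integrable_gain (a c : A → ℝ) :
    Integrable (fun z : ℝ => (⨆ x, (a x + c x * z)) - ⨆ x, a x) (gaussianReal 0 1) := by
  refine Integrable.mono' (g := fun z => (∑ x, |c x|) * |z|)
    (integrable_id_gaussianReal.abs.const_mul _)
    ((measurable_iSup_line a c).sub_const _).aestronglyMeasurable (ae_of_all _ fun z => ?_)
  refine (abs_iSup_sub_iSup_le _ _).trans (le_of_eq ?_)
  rw [Finset.sum_mul]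
  exact Finset.sum_congr rfl fun x _ => by rw [add_sub_cancel_left, abs_mul]

lemma continuous_iSup_line (a c : A → ℝ) : Continuous fun z : ℝ => ⨆ x, (a x + c x * z) := by
  simp_rw [← Finset.sup'_univ_eq_ciSup]
  exact Continuous.finset_sup'_apply _ fun x _ => by fun_prop

/-- The gain is Lipschitz in the coefficients of the lines. -/
lemma abs_gain_sub_gain_le (a c a' c' : A → ℝ) :
    |gain a c - gain a' c'| ≤ 2 * ∑ x, |a x - a' x|
      + (∑ x, |c x - c' x|) * ∫ z, |z| ∂(gaussianReal 0 1) := by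
  unfold gain
  rw [← integral_sub (integrable_gain _ _) (integrable_gain _ _)]
  refine (abs_integral_le_integral_abs).trans ?_
  have hi : Integrable (fun z : ℝ => 2 * ∑ x, |a x - a' x| + (∑ x, |c x - c' x|) * |z|)
      (gaussianReal 0 1) :=
    (integrable_const _).add (integrable_id_gaussianReal.abs.const_mul _)
  refine (integral_mono ((integrable_gain _ _).sub (integrable_gain _ _)).abs hi
    fun z => ?_).trans (le_of_eq ?_)
  · have h1 := abs_iSup_sub_iSup_le (fun x => a x + c x * z) (fun x => a' x + c' x * z)
    have h2 := abs_iSup_sub_iSup_le a a'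
    have h3 : ∑ x, |a x + c x * z - (a' x + c' x * z)|
        ≤ ∑ x, |a x - a' x| + (∑ x, |c x - c' x|) * |z| := by
      rw [Finset.sum_mul, ← Finset.sum_add_distrib]
      refine Finset.sum_le_sum fun x _ => ?_
      rw [← abs_mul]
      exact (le_of_eq (by congr 1; ring)).trans (abs_add_le _ _)
    rw [abs_le] at h1 h2
    simp only [Pi.sub_apply]
    rw [abs_le]
    constructor <;> linarith [h1.1, h1.2, h2.1, h2.2]
  · rw [integral_add (integrable_const _) (integrable_id_gaussianReal.abs.const_mul _)]
    simp [integral_const_mul]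

lemma tendsto_gain {a c : ℕ → A → ℝ} {a' c' : A → ℝ}
    (ha : ∀ x, Tendsto (fun n => a n x) atTop (𝓝 (a' x)))
    (hc : ∀ x, Tendsto (fun n => c n x) atTop (𝓝 (c' x))) :
    Tendsto (fun n => gain (a n) (c n)) atTop (𝓝 (gain a' c')) := by
  rw [tendsto_iff_dist_tendsto_zero]
  refine squeeze_zero (fun _ => dist_nonneg)
    (fun n => abs_gain_sub_gain_le (a n) (c n) a' c') ?_
  have h : ∀ {b : ℕ → A → ℝ} {b' : A → ℝ}, (∀ x, Tendsto (fun n => b n x) atTop (𝓝 (b' x))) →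
      Tendsto (fun n => ∑ x, |b n x - b' x|) atTop (𝓝 0) := by
    intro b b' hb
    have := tendsto_finsetSum Finset.univ fun x _ => ((hb x).sub_const (b' x)).abs
    simpa using this
  simpa using ((h ha).const_mul 2).add ((h hc).mul_const _)

/-- The gap between the maximum of the lines and the line of a maximizer of `a` is nonnegative and
its integral is `gain a c`. If the latter vanishes, then no line ever exceeds the line of that
maximizer, and so the lines are parallel. -/
lemma slopes_eq_of_gain_nonpos {a c : A → ℝ} (h : gain a c ≤ 0) (x x' : A) : c x = c x' := by
  obtain ⟨y, hy⟩ := exists_eq_ciSup_of_finite (f := a)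
  set g : ℝ → ℝ := fun z => ((⨆ x, (a x + c x * z)) - ⨆ x, a x) - c y * z with hg
  have hg0 : ∀ z, 0 ≤ g z := by
    intro z
    have := le_ciSup (Set.finite_range fun x => a x + c x * z).bddAbove y
    simp only [hg, ← hy]
    linarith
  have hgi : Integrable g (gaussianReal 0 1) :=
    (integrable_gain a c).sub (integrable_id_gaussianReal.const_mul _)
  have hgz : ∫ z, g z ∂(gaussianReal 0 1) = gain a c := by
    rw [hg, integral_sub (integrable_gain a c) (integrable_id_gaussianReal.const_mul _),
      integral_const_mul, integral_id_gaussianReal, mul_zero, sub_zero, gain]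
  have hae : g =ᵐ[gaussianReal 0 1] 0 := (integral_eq_zero_iff_of_nonneg hg0 hgi).1
    (le_antisymm (hgz.trans_le h) (integral_nonneg hg0))
  have hzero : g = 0 := (Continuous.ae_eq_iff_eq volume
    (((continuous_iSup_line a c).sub continuous_const).sub (by fun_prop)) continuous_const).1
      ((gaussianReal_absolutelyContinuous' 0 one_ne_zero).ae_eq hae)
  have key : ∀ x, c x = c y := by
    intro x
    have h1 : ∀ z, (c x - c y) * z ≤ a y - a x := by
      intro z
      have h2 := le_ciSup (Set.finite_range fun x => a x + c x * z).bddAbove x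
      have h3 := congrFun hzero z
      simp only [hg, Pi.zero_apply, ← hy] at h3
      linarith
    by_contra hne
    have h4 := h1 ((a y - a x + 1) / (c x - c y))
    rw [mul_div_cancel₀ _ (sub_ne_zero.2 hne)] at h4
    linarith
  rw [key x, key x']

end

/-! ### States along a path -/

section

variable {A W : Type*} [Fintype A] [Fintype W]

/-- The slope of the posterior mean of `G x` as a function of the observation at `u`, when the
latter is measured in units of its standard deviation. -/
def slope (p : W → ℝ) (lam : A × W → ℝ) (s : State A W) (u : A × W) (x : A) : ℝ :=
  ∑ w, s.2 (x, w) u / √(s.2 u u + lam u) * p w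

/-- The coefficients of `G x - G x'` as a linear combination of the values of `F`. -/
def contrast [DecidableEq A] (p : W → ℝ) (x x' : A) (v : A × W) : ℝ :=
  (if v.1 = x then p v.2 else 0) - if v.1 = x' then p v.2 else 0

lemma sum_contrast_mul [DecidableEq A] (p : W → ℝ) (x x' : A) (g : A × W → ℝ) :
    ∑ v, contrast p x x' v * g v = ∑ w, g (x, w) * p w - ∑ w, g (x', w) * p w := by
  simp only [contrast, sub_mul, ite_mul, zero_mul, Finset.sum_sub_distrib, Fintype.sum_prod_type,
    Finset.sum_ite_irrel, Finset.sum_const_zero, Finset.sum_ite_eq', Finset.mem_univ, if_true,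
    mul_comm]

variable [DecidableEq A] [DecidableEq W]

/-- The variances of all linear combinations of the values of `F` decrease along the path, so the
kernels converge, by polarization. -/
lemma exists_tendsto_kernel {lam : A × W → ℝ} (hlam : ∀ u, 0 ≤ lam u) {S : ℕ → State A W}
    {u : ℕ → A × W} {y : ℕ → ℝ} (hS : ∀ n, IsGP (S n))
    (hstep : ∀ n, S (n + 1) = update lam (S n) (u n) (y n)) (m : A × W → ℝ) :
    ∃ T : A × W → A × W → ℝ, IsGP (m, T) ∧
      ∀ v v', Tendsto (fun n => (S n).2 v v') atTop (𝓝 (T v v')) := by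
  have hq : ∀ f, ∃ q, Tendsto (fun n => quad (S n).2 f) atTop (𝓝 q) := by
    intro f
    refine ⟨_, tendsto_atTop_ciInf (antitone_nat_of_succ_le fun n => ?_)
      ⟨0, Set.forall_mem_range.2 fun n => (hS n).quad_nonneg f⟩⟩
    rw [hstep, quad_update]
    have := div_nonneg (sq_nonneg (∑ v, f v * (S n).2 v (u n)))
      (add_nonneg ((hS n).diag_nonneg (u n)) (hlam (u n)))
    linarith
  choose Q hQ using hq
  have hT : ∀ v v', Tendsto (fun n => (S n).2 v v') atTop
      (𝓝 ((Q (Pi.single v 1 + Pi.single v' 1) - Q (Pi.single v 1) - Q (Pi.single v' 1)) / 2)) := by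
    intro v v'
    refine ((((hQ (Pi.single v 1 + Pi.single v' 1)).sub (hQ (Pi.single v 1))).sub
      (hQ (Pi.single v' 1))).div_const 2).congr fun n => ?_
    rw [quad_add_single (hS n).symm, quad_single, quad_single]
    simp only [Pi.single_apply, ite_mul, one_mul, zero_mul, Finset.sum_ite_eq', Finset.mem_univ,
      if_true]
    ring
  refine ⟨_, (isGP_iff _).2 ⟨fun v v' => ?_, fun f => ?_⟩, hT⟩
  · exact tendsto_nhds_unique (hT v v') ((hT v' v).congr fun n => (hS n).symm v' v)
  · exact ge_of_tendsto' (tendsto_quad hT f) fun n => (hS n).quad_nonneg f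

/-- If the evaluated points maximize the value of information, and the posterior means converge,
then all posterior variances of differences `G x - G x'` tend to zero. -/
theorem tendsto_quad_contrast_zero [Nonempty A] (p : W → ℝ) {lam : A × W → ℝ}
    (hlam : ∀ u, 0 ≤ lam u) {S : ℕ → State A W}
    {u : ℕ → A × W} {y : ℕ → ℝ} (hS : ∀ n, IsGP (S n))
    (hstep : ∀ n, S (n + 1) = update lam (S n) (u n) (y n))
    {m : A × W → ℝ} (hm : ∀ v, Tendsto (fun n => (S n).1 v) atTop (𝓝 (m v)))
    (hmax : ∀ n v, gain (meanG p (S n)) (slope p lam (S n) v)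
      ≤ gain (meanG p (S n)) (slope p lam (S n) (u n))) (x x' : A) :
    Tendsto (fun n => quad (S n).2 (contrast p x x')) atTop (𝓝 0) := by
  obtain ⟨T, hTGP, hT⟩ := exists_tendsto_kernel hlam hS hstep m
  have hmean : ∀ x, Tendsto (fun n => meanG p (S n) x) atTop (𝓝 (meanG p (m, T) x)) := fun x =>
    tendsto_finsetSum _ fun w _ => (hm (x, w)).mul_const _
  have hslope : ∀ v, 0 < T v v + lam v → ∀ x,
      Tendsto (fun n => slope p lam (S n) v x) atTop (𝓝 (slope p lam (m, T) v x)) := by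
    intro v hv x
    refine tendsto_finsetSum _ fun w _ => ((hT (x, w) v).div ?_ ?_).mul_const _
    · exact ((hT v v).add_const _).sqrt
    · exact (Real.sqrt_pos.2 hv).ne'
  -- some point `v₀` is evaluated infinitely often
  obtain ⟨v₀, hv₀⟩ : ∃ v₀, ∃ᶠ n in atTop, u n = v₀ := by
    by_contra hcon
    simp only [not_exists, not_frequently] at hcon
    obtain ⟨n, hn⟩ := (eventually_all.2 hcon).exists
    exact hn (u n) rfl
  have hdiag : T v₀ v₀ = 0 := by
    by_contra hne
    have hpos : 0 < T v₀ v₀ := lt_of_le_of_ne (hTGP.diag_nonneg v₀) (Ne.symm hne)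
    have hd : 0 < T v₀ v₀ + lam v₀ := by linarith [hlam v₀]
    have hlim : Tendsto (fun n => (S n).2 v₀ v₀ - (S (n + 1)).2 v₀ v₀
        - (S n).2 v₀ v₀ * (S n).2 v₀ v₀ / ((S n).2 v₀ v₀ + lam v₀)) atTop
        (𝓝 (T v₀ v₀ - T v₀ v₀ - T v₀ v₀ * T v₀ v₀ / (T v₀ v₀ + lam v₀))) :=
      ((hT v₀ v₀).sub ((tendsto_add_atTop_iff_nat 1).2 (hT v₀ v₀))).sub
        (((hT v₀ v₀).mul (hT v₀ v₀)).div ((hT v₀ v₀).add_const _) hd.ne')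
    have hfreq : ∃ᶠ n in atTop, (S n).2 v₀ v₀ - (S (n + 1)).2 v₀ v₀
        - (S n).2 v₀ v₀ * (S n).2 v₀ v₀ / ((S n).2 v₀ v₀ + lam v₀) = 0 := by
      refine hv₀.mono fun n hn => ?_
      rw [hstep, hn]
      simp only [update]
      ring
    have h0 := isClosed_singleton.mem_of_frequently_of_tendsto hfreq hlim
    have : 0 < T v₀ v₀ * T v₀ v₀ / (T v₀ v₀ + lam v₀) := by positivity
    rw [Set.mem_singleton_iff] at h0
    linarith
  have hslope₀ : ∀ x, Tendsto (fun n => slope p lam (S n) v₀ x) atTop (𝓝 0) := by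
    intro x
    rcases (hlam v₀).eq_or_lt with hl | hl
    · -- without noise, one evaluation at `v₀` reveals `F(v₀)`
      obtain ⟨k, hk⟩ := hv₀.exists
      have hzero : ∀ n, k + 1 ≤ n → (S n).2 v₀ v₀ = 0 := by
        intro n hn
        induction n, hn using Nat.le_induction with
        | base =>
          rw [hstep, hk]
          simp only [update, ← hl, add_zero, mul_self_div_self, sub_self]
        | succ n _ ih =>
          rw [hstep]
          simp [update, ih, (hS n).symm v₀ (u n), (hS n).eq_zero_of_diag_eq_zero ih (u n)]
      refine tendsto_const_nhds.congr' ?_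
      filter_upwards [eventually_ge_atTop (k + 1)] with n hn
      simp [slope, (hS n).eq_zero_of_diag_eq_zero (hzero n hn)]
    · have h := hslope v₀ (by rw [hdiag]; linarith) x
      have hz : slope p lam (m, T) v₀ x = 0 :=
        Finset.sum_eq_zero fun w _ => by
          rw [hTGP.eq_zero_of_diag_eq_zero hdiag, zero_div, zero_mul]
      rwa [hz] at h
  have hgain₀ : Tendsto (fun n => gain (meanG p (S n)) (slope p lam (S n) v₀)) atTop (𝓝 0) := by
    rw [← gain_zero (meanG p (m, T))]
    exact tendsto_gain hmean hslope₀
  have hgain : ∀ v, 0 < T v v + lam v → gain (meanG p (m, T)) (slope p lam (m, T) v) ≤ 0 := by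
    intro v hv
    have hlim := (tendsto_gain hmean (hslope v hv)).sub hgain₀
    rw [sub_zero] at hlim
    exact isClosed_Iic.mem_of_frequently_of_tendsto
      (hv₀.mono fun n hn => by rw [Set.mem_Iic, sub_nonpos, ← hn]; exact hmax n v) hlim
  have hquad : quad T (contrast p x x') = 0 := by
    refine quad_eq_zero_of_forall fun v => ?_
    have hv0 : 0 ≤ T v v := hTGP.diag_nonneg v
    rcases hv0.eq_or_lt with hv | hv
    · have hTv : ∀ w, T w v = 0 := hTGP.eq_zero_of_diag_eq_zero hv.symm
      exact Finset.sum_eq_zero fun w _ => by rw [hTv, mul_zero]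
    have hd : 0 < T v v + lam v := add_pos_of_pos_of_nonneg hv (hlam v)
    have hpar := slopes_eq_of_gain_nonpos (hgain v hd) x x'
    rw [sum_contrast_mul p x x' fun w => T w v, sub_eq_zero]
    simp only [slope, div_mul_eq_mul_div, ← Finset.sum_div] at hpar
    exact (div_left_inj' (Real.sqrt_pos.2 hd).ne').1 hpar
  rw [← hquad]
  exact tendsto_quad hT _

end

/-! ### One step of Gaussian conditioning -/

/-- If `X` is independent of `(Y, Z)` and `Y` of `Z`, then `X`, `Y` and `Z` are
independent. -/
lemma indepFun_prodMk_of_indepFun {Ω α β γ : Type*} [MeasurableSpace Ω] [MeasurableSpace α]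
    [MeasurableSpace β] [MeasurableSpace γ] {P : Measure Ω} [IsProbabilityMeasure P]
    {X : Ω → α} {Y : Ω → β} {Z : Ω → γ} (hX : Measurable X) (hY : Measurable Y) (hZ : Measurable Z)
    (h : IndepFun X (fun ω => (Y ω, Z ω)) P) (h' : IndepFun Y Z P) :
    IndepFun (fun ω => (X ω, Y ω)) Z P := by
  have hXY : IndepFun X Y P := h.comp measurable_id measurable_fst
  have : IsProbabilityMeasure (P.map X) := Measure.isProbabilityMeasure_map hX.aemeasurable
  have : IsProbabilityMeasure (P.map Y) := Measure.isProbabilityMeasure_map hY.aemeasurable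
  have : IsProbabilityMeasure (P.map Z) := Measure.isProbabilityMeasure_map hZ.aemeasurable
  rw [indepFun_iff_map_prod_eq_prod_map_map (by fun_prop) (by fun_prop)] at h h' hXY ⊢
  rw [hXY, ← MeasurableEquiv.prodAssoc.map_measurableEquiv_injective.eq_iff,
    Measure.prodAssoc_prod, ← h', ← h, Measure.map_map (by fun_prop) (by fun_prop)]
  rfl

lemma indepFun_comp_measurePreserving {Ω Ω' α β : Type*} [MeasurableSpace Ω] [MeasurableSpace Ω']
    [MeasurableSpace α] [MeasurableSpace β] {P : Measure Ω} {Q : Measure Ω'} {f : Ω' → α}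
    {g : Ω' → β} (h : IndepFun f g Q) (hf : Measurable f) (hg : Measurable g) {T : Ω → Ω'}
    (hT : MeasurePreserving T P Q) : IndepFun (f ∘ T) (g ∘ T) P := by
  rw [indepFun_iff_measure_inter_preimage_eq_mul] at h ⊢
  intro s t hs ht
  rw [Set.preimage_comp, Set.preimage_comp, ← Set.preimage_inter,
    hT.measure_preimage ((hf hs).inter (hg ht)).nullMeasurableSet,
    hT.measure_preimage (hf hs).nullMeasurableSet, hT.measure_preimage (hg ht).nullMeasurableSet,
    h s t hs ht]

section

variable {Ω ι : Type*} [MeasurableSpace Ω] {P : Measure Ω} [Fintype ι]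
  {K : ι → ι → ℝ} {R : ι → Ω → ℝ} {e : Ω → ℝ}

/-- Suppose that the centered Gaussian vector `R` has the covariance kernel `K` and that the noise
`e` is standard normal and independent of `R`. Then the residual of `R` after regression on the
innovation `R u + c * e` is Gaussian, centered, and independent of the innovation, and its
covariance kernel is the posterior kernel. -/
theorem gaussian_residual (hR : HasGaussianLaw (fun ω v => R v ω) P) (he : HasGaussianLaw e P)
    (hind : IndepFun (fun ω v => R v ω) e P) (hR0 : ∀ v, ∫ ω, R v ω ∂P = 0)
    (he0 : ∫ ω, e ω ∂P = 0) (he1 : cov[e, e; P] = 1)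
    (hK : ∀ v v', cov[R v, R v'; P] = K v v') (u : ι) {c l : ℝ} (hc : c ^ 2 = l)
    (hdeg : K u u + l = 0 → ∀ v, K v u = 0) :
    HasGaussianLaw (fun ω v => R v ω - K v u / (K u u + l) * (R u ω + c * e ω)) P ∧
    (∀ v, ∫ ω, (R v ω - K v u / (K u u + l) * (R u ω + c * e ω)) ∂P = 0) ∧
    (∀ v v', cov[fun ω => R v ω - K v u / (K u u + l) * (R u ω + c * e ω),
      fun ω => R v' ω - K v' u / (K u u + l) * (R u ω + c * e ω); P]
        = K v v' - K v u * K v' u / (K u u + l)) ∧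
    IndepFun (fun ω v => R v ω - K v u / (K u u + l) * (R u ω + c * e ω))
      (fun ω => R u ω + c * e ω) P ∧
    HasGaussianLaw (fun ω => R u ω + c * e ω) P ∧
    ∫ ω, (R u ω + c * e ω) ∂P = 0 ∧
    cov[fun ω => R u ω + c * e ω, fun ω => R u ω + c * e ω; P] = K u u + l := by
  have hP : IsProbabilityMeasure P := he.isProbabilityMeasure
  have hRv : ∀ v, MemLp (R v) 2 P := fun v => (hR.eval v).memLp_two
  have heL : MemLp e 2 P := he.memLp_two
  have hce : MemLp (fun ω => c * e ω) 2 P := heL.const_mul c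
  have hI : MemLp (fun ω => R u ω + c * e ω) 2 P := (hRv u).add hce
  have hRe : ∀ v, cov[R v, e; P] = 0 := fun v =>
    (hind.comp (measurable_pi_apply v) measurable_id).covariance_eq_zero (hRv v) heL
  have hRI : ∀ v, cov[R v, fun ω => R u ω + c * e ω; P] = K v u := by
    intro v
    change cov[R v, R u + fun ω => c * e ω; P] = _
    rw [covariance_add_right (hRv v) (hRv u) hce, covariance_const_mul_right, hRe, hK]
    ring
  have hII : cov[fun ω => R u ω + c * e ω, fun ω => R u ω + c * e ω; P] = K u u + l := by
    change cov[R u + fun ω => c * e ω, fun ω => R u ω + c * e ω; P] = _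
    rw [covariance_add_left (hRv u) hce hI, hRI, covariance_const_mul_left, covariance_comm]
    change _ + c * cov[R u + fun ω => c * e ω, e; P] = _
    rw [covariance_add_left (hRv u) hce heL, hRe, covariance_const_mul_left, he1, ← hc]
    ring
  have hkI : ∀ v, MemLp (fun ω => K v u / (K u u + l) * (R u ω + c * e ω)) 2 P :=
    fun v => hI.const_mul _
  have hR'I : ∀ v, cov[fun ω => R v ω - K v u / (K u u + l) * (R u ω + c * e ω),
      fun ω => R u ω + c * e ω; P] = 0 := by
    intro v
    rw [covariance_fun_sub_left (hRv v) (hkI v) hI, hRI, covariance_const_mul_left, hII,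
      div_mul_cancel_of_imp fun h => hdeg h v, sub_self]
  have hI0 : ∫ ω, (R u ω + c * e ω) ∂P = 0 := by
    rw [integral_add ((hRv u).integrable one_le_two) (hce.integrable one_le_two),
      integral_const_mul, hR0, he0]
    ring
  -- the residual and the innovation are a linear image of `(R, e)`
  let I : ((ι → ℝ) × ℝ) →ₗ[ℝ] ℝ :=
    LinearMap.proj u ∘ₗ LinearMap.fst ℝ _ _ + c • LinearMap.snd ℝ _ _
  let L : ((ι → ℝ) × ℝ) →ₗ[ℝ] (ι → ℝ) × (Unit → ℝ) :=
    (LinearMap.pi fun v => LinearMap.proj v ∘ₗ LinearMap.fst ℝ _ _ - (K v u / (K u u + l)) • I).prod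
      (LinearMap.pi fun _ => I)
  have hjoint : HasGaussianLaw (fun ω =>
      ((fun v => R v ω - K v u / (K u u + l) * (R u ω + c * e ω)),
        fun _ : Unit => R u ω + c * e ω)) P :=
    (IndepFun.hasGaussianLaw hR he hind).map_fun (LinearMap.toContinuousLinearMap L)
  refine ⟨hjoint.fst, fun v => ?_, fun v v' => ?_, ?_, hjoint.snd.eval (), hI0, hII⟩
  · rw [integral_sub ((hRv v).integrable one_le_two) ((hkI v).integrable one_le_two),
      integral_const_mul, hR0, hI0]
    ring
  · have hR'L : MemLp (fun ω => R v ω - K v u / (K u u + l) * (R u ω + c * e ω)) 2 P :=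
      (hRv v).sub (hkI v)
    rw [covariance_fun_sub_right hR'L (hRv v') (hkI v'),
      covariance_const_mul_right, hR'I, covariance_fun_sub_left (hRv v) (hkI v) (hRv v'),
      covariance_const_mul_left, covariance_comm (fun ω => R u ω + c * e ω) (R v'), hRI, hK]
    ring
  · have := hjoint.indepFun_of_covariance_eval fun v _ => hR'I v
    exact this.comp measurable_id (measurable_pi_apply ())

end

/-! ### The law of the process and the noise -/

section

variable {A W : Type*} [Fintype A] [Fintype W] [DecidableEq A] [DecidableEq W]

instance isProbabilityMeasure_law (s : State A W) : IsProbabilityMeasure (law s) := by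
  unfold law; infer_instance

lemma hasGaussianLaw_process (s : State A W) :
    HasGaussianLaw (fun (ω : Outcome A W) (v : A × W) => ω.1 v) (law s) := by
  have h : HasGaussianLaw (fun ω : Outcome A W => ω.1) (law s) := by
    refine ⟨?_⟩
    change IsGaussian ((law s).map Prod.fst)
    rw [law, Measure.map_fst_prod, measure_univ, one_smul]
    infer_instance
  exact h.map_fun (EuclideanSpace.equiv (A × W) ℝ).toContinuousLinearMap

lemma measurePreserving_fst_law (s : State A W) : MeasurePreserving (Prod.fst) (law s)
    (multivariateGaussian (WithLp.toLp 2 s.1) (Matrix.of s.2)) :=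
  measurePreserving_fst

lemma measurePreserving_noise (s : State A W) (n : ℕ) :
    MeasurePreserving (fun ω : Outcome A W => ω.2 n) (law s) (gaussianReal 0 1) :=
  (measurePreserving_eval_infinitePi (fun _ : ℕ => gaussianReal 0 1) n).comp measurePreserving_snd

lemma hasGaussianLaw_noise (s : State A W) (n : ℕ) :
    HasGaussianLaw (fun ω : Outcome A W => ω.2 n) (law s) :=
  ⟨by rw [(measurePreserving_noise s n).map_eq]; infer_instance⟩

lemma integral_noise (s : State A W) (n : ℕ) : ∫ ω, ω.2 n ∂(law s) = 0 := by
  have h := (measurePreserving_noise s n).hasLaw.integral_eq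
  rwa [integral_id_gaussianReal] at h

lemma covariance_noise (s : State A W) (n : ℕ) :
    cov[fun ω : Outcome A W => ω.2 n, fun ω => ω.2 n; law s] = 1 := by
  rw [covariance_self (measurePreserving_noise s n).measurable.aemeasurable,
    (measurePreserving_noise s n).hasLaw.variance_eq, variance_id_gaussianReal]
  rfl

lemma integral_process (s : State A W) (v : A × W) : ∫ ω, ω.1 v ∂(law s) = s.1 v := by
  have h := (measurePreserving_fst_law s).hasLaw.integral_comp
    (f := fun x : EuclideanSpace ℝ (A × W) => x v) (by fun_prop)
  refine h.trans ?_
  have h2 := (EuclideanSpace.proj (𝕜 := ℝ) v).integral_comp_id_comm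
    (μ := multivariateGaussian (WithLp.toLp 2 s.1) (Matrix.of s.2)) IsGaussian.integrable_id
  simp only [integral_id_multivariateGaussian] at h2
  simpa using h2

lemma covariance_process {s : State A W} (hs : IsGP s) (v v' : A × W) :
    cov[fun ω => ω.1 v, fun ω => ω.1 v'; law s] = s.2 v v' := by
  have h := (measurePreserving_fst_law s).hasLaw.covariance_fun_comp
    (f := fun x : EuclideanSpace ℝ (A × W) => x v) (g := fun x => x v') (by fun_prop) (by fun_prop)
  rw [h, covariance_eval_multivariateGaussian hs]
  rfl

/-- The noise of a stage is independent of the process and of the earlier noise. -/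
lemma indepFun_noise (s : State A W) (n : ℕ) :
    IndepFun (fun ω : Outcome A W => (ω.1, fun i : Finset.range n => ω.2 i)) (fun ω => ω.2 n)
      (law s) := by
  refine indepFun_prodMk_of_indepFun (by fun_prop) (by fun_prop) (by fun_prop) ?_ ?_
  · exact indepFun_prod (X := fun x => x)
      (Y := fun y : ℕ → ℝ => ((fun i : Finset.range n => y i), y n)) (by fun_prop) (by fun_prop)
  · have h := (iIndepFun_infinitePi (P := fun _ : ℕ => gaussianReal 0 1) (X := fun _ x => x)
      fun _ => measurable_id).indepFun_finset (Finset.range n) {n} (by simp)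
        fun i => measurable_pi_apply i
    have hm : Measurable fun y : ({n} : Finset ℕ) → ℝ => y ⟨n, Finset.mem_singleton_self n⟩ :=
      measurable_pi_apply _
    have h' := h.comp measurable_id hm
    exact indepFun_comp_measurePreserving (P := law s) h' (by fun_prop) (by fun_prop)
      measurePreserving_snd

lemma hasGaussianLaw_centered (s : State A W) :
    HasGaussianLaw (fun (ω : Outcome A W) v => ω.1 v - s.1 v) (law s) := by
  have h := (hasGaussianLaw_process s).isGaussian_map
  refine ⟨?_⟩
  have : (fun (ω : Outcome A W) v => ω.1 v - s.1 v)
      = (fun x : A × W → ℝ => x - s.1) ∘ fun ω v => ω.1 v := rfl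
  rw [this, ← Measure.map_map (by fun_prop) (by fun_prop)]
  infer_instance

lemma integrable_process (s : State A W) (v : A × W) :
    Integrable (fun ω : Outcome A W => ω.1 v) (law s) :=
  ((hasGaussianLaw_process s).eval v).integrable

lemma integral_centered (s : State A W) (v : A × W) : ∫ ω, (ω.1 v - s.1 v) ∂(law s) = 0 := by
  rw [integral_sub (integrable_process s v) (integrable_const _), integral_process]
  simp

lemma covariance_centered {s : State A W} (hs : IsGP s) (v v' : A × W) :
    cov[fun ω => ω.1 v - s.1 v, fun ω => ω.1 v' - s.1 v'; law s] = s.2 v v' := by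
  rw [covariance_sub_const_left (integrable_process s v),
    covariance_sub_const_right (integrable_process s v'), covariance_process hs]

/-- Where the observation has variance zero and the posterior update divides by zero, the
numerators vanish as well. -/
lemma IsGP.degenerate {lam : A × W → ℝ} (hlam : ∀ u, 0 ≤ lam u) {s : State A W} (hs : IsGP s)
    (u : A × W) (h : s.2 u u + lam u = 0) (v : A × W) : s.2 v u = 0 :=
  hs.eq_zero_of_diag_eq_zero (by linarith [hs.diag_nonneg u, hlam u]) v

/-- The value of information is the expected gain of the maximum of the posterior means of `G x`,
which are lines in the standardized observation. -/
lemma voi_eq_gain (p : W → ℝ) {lam : A × W → ℝ} (hlam : ∀ u, 0 ≤ lam u) {s : State A W}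
    (hs : IsGP s) (u : A × W) : voi p lam s u = gain (meanG p s) (slope p lam s u) := by
  have hind : IndepFun (fun (ω : Outcome A W) v => ω.1 v - s.1 v) (fun ω => ω.2 0) (law s) :=
    (indepFun_noise s 0).comp 
      (φ := fun (q : EuclideanSpace ℝ (A × W) × (Finset.range 0 → ℝ)) v => q.1 v - s.1 v)
      (by fun_prop) measurable_id
  obtain ⟨-, -, -, -, hG, hG0, hGv⟩ := gaussian_residual
    (R := fun v (ω : Outcome A W) => ω.1 v - s.1 v) (hasGaussianLaw_centered s)
    (hasGaussianLaw_noise s 0) hind (integral_centered s) (integral_noise s 0)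
    (covariance_noise s 0) (covariance_centered hs) u (Real.sq_sqrt (hlam u))
    (hs.degenerate hlam u)
  set d := s.2 u u + lam u with hd
  have hd0 : 0 ≤ d := add_nonneg (hs.diag_nonneg u) (hlam u)
  have hlaw : (law s).map (fun ω => ω.1 u - s.1 u + √(lam u) * ω.2 0)
      = (gaussianReal 0 1).map fun z => √d * z := by
    rw [hG.map_eq_gaussianReal, gaussianReal_map_const_mul, hG0,
      ← covariance_self hG.aemeasurable, hGv]
    congr 1
    · simp
    · ext; simp [hd0]
  have hmeas : Measurable fun t : ℝ =>
      (⨆ x, (meanG p s x + (∑ w, s.2 (x, w) u / d * p w) * t)) - ⨆ x, meanG p s x :=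
    (measurable_iSup_line _ _).sub_const _
  have h1 : voi p lam s u = ∫ ω, (fun t : ℝ =>
      (⨆ x, (meanG p s x + (∑ w, s.2 (x, w) u / d * p w) * t)) - ⨆ x, meanG p s x)
        (ω.1 u - s.1 u + √(lam u) * ω.2 0) ∂(law s) := by
    refine integral_congr_ae (ae_of_all _ fun ω => ?_)
    dsimp only
    congr 2 with x
    simp only [meanG, update, obs, Finset.sum_mul, ← Finset.sum_add_distrib]
    exact Finset.sum_congr rfl fun w _ => by rw [← hd]; ring
  rw [h1, ← integral_map hG.aemeasurable hmeas.aestronglyMeasurable, hlaw,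
    integral_map (by fun_prop) hmeas.aestronglyMeasurable, gain]
  refine integral_congr_ae (ae_of_all _ fun z => ?_)
  dsimp only
  congr 2 with x
  rw [slope, ← mul_assoc, Finset.sum_mul]
  congr 2
  refine Finset.sum_congr rfl fun w _ => ?_
  rw [← hd]
  have : s.2 (x, w) u / √d = s.2 (x, w) u / d * √d := by
    rw [div_mul_eq_mul_div, mul_div_assoc, Real.sqrt_div_self', mul_one_div]
  rw [this]; ring

end

/-! ### Histories -/

section

variable {A W : Type*}

lemma measurable_update (lam : A × W → ℝ) (u : A × W) :
    Measurable fun q : State A W × ℝ => update lam q.1 u q.2 := by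
  unfold update
  refine Measurable.prodMk (measurable_pi_lambda _ fun v => ?_)
    (measurable_pi_lambda _ fun v => measurable_pi_lambda _ fun v' => ?_) <;>
  fun_prop

lemma measurable_of_finite_cases {Ω ι β : Type*} [Finite ι] [MeasurableSpace Ω]
    [MeasurableSpace β] {g : Ω → ι} (hg : ∀ i, MeasurableSet {ω | g ω = i}) {f : ι → Ω → β}
    (hf : ∀ i, Measurable (f i)) : Measurable fun ω => f (g ω) ω := by
  intro t ht
  have : (fun ω => f (g ω) ω) ⁻¹' t = ⋃ i, {ω | g ω = i} ∩ f i ⁻¹' t := by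
    ext ω; simp
  rw [this]
  exact MeasurableSet.iUnion fun i => (hg i).inter (hf i ht)

lemma measurable_obs (lam : A × W → ℝ) (n : ℕ) (u : A × W) : Measurable (obs lam n u) := by
  unfold obs; fun_prop

variable (lam : A × W → ℝ) (π : Policy A W) (s : State A W)

lemma history_succ (n : ℕ) :
    history lam π s (n + 1) = history lam π s n ⊔
      (MeasurableSpace.comap (pointAt lam π s n) ⊤ ⊔
        MeasurableSpace.comap (obsAt lam π s n) inferInstance) := by
  refine le_antisymm (iSup_le fun i => ?_) (sup_le (iSup_le fun i => ?_) ?_)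
  · rcases (Nat.lt_succ_iff.1 i.2).lt_or_eq with h | h
    · exact le_sup_of_le_left (le_iSup (fun i : Fin n =>
        (MeasurableSpace.comap (pointAt lam π s i) ⊤ ⊔
          MeasurableSpace.comap (obsAt lam π s i) inferInstance)) ⟨i, h⟩)
    · rw [h]; exact le_sup_right
  · exact le_iSup (fun i : Fin (n + 1) =>
        (MeasurableSpace.comap (pointAt lam π s i) ⊤ ⊔
          MeasurableSpace.comap (obsAt lam π s i) inferInstance)) i.castSucc
  · exact le_iSup (fun i : Fin (n + 1) =>
        (MeasurableSpace.comap (pointAt lam π s i) ⊤ ⊔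
          MeasurableSpace.comap (obsAt lam π s i) inferInstance)) (Fin.last n)

lemma history_mono : Monotone (history lam π s) :=
  monotone_nat_of_le_succ fun n => by rw [history_succ]; exact le_sup_left

lemma measurable_obsAt_history {i n : ℕ} (h : i < n) :
    Measurable[history lam π s n] (obsAt lam π s i) := by
  have hle : MeasurableSpace.comap (obsAt lam π s i) inferInstance ≤ history lam π s n :=
    le_trans (by rw [history_succ]; exact le_sup_of_le_right le_sup_right)
      (history_mono lam π s (Nat.succ_le_of_lt h))
  exact (comap_measurable _).mono hle le_rfl

lemma measurableSet_pointAt {m : MeasurableSpace (Outcome A W)} {n : ℕ}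
    (h : Measurable[m] (stateAt lam π s n)) (u : A × W) :
    MeasurableSet[m] {ω | pointAt lam π s n ω = u} :=
  h (π.measurableSet_act n u)

lemma comap_pointAt_le [Finite A] [Finite W] {m : MeasurableSpace (Outcome A W)} {n : ℕ}
    (h : Measurable[m] (stateAt lam π s n)) : MeasurableSpace.comap (pointAt lam π s n) ⊤ ≤ m := by
  rintro _ ⟨t, -, rfl⟩
  have : pointAt lam π s n ⁻¹' t = ⋃ u ∈ t, {ω | pointAt lam π s n ω = u} := by
    ext ω; simp
  rw [this]
  exact MeasurableSet.biUnion t.to_countable fun u _ => measurableSet_pointAt lam π s h u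

lemma measurable_stateAt_succ [Finite A] [Finite W] {m : MeasurableSpace (Outcome A W)} {n : ℕ}
    (h : Measurable[m] (stateAt lam π s n)) (h' : Measurable[m] (obsAt lam π s n)) :
    Measurable[m] (stateAt lam π s (n + 1)) :=
  measurable_of_finite_cases (measurableSet_pointAt lam π s h)
    fun u => (measurable_update lam u).comp (h.prodMk h')

lemma measurable_stateAt_history [Finite A] [Finite W] (n : ℕ) :
    Measurable[history lam π s n] (stateAt lam π s n) := by
  induction n with
  | zero => exact measurable_const
  | succ n ih =>
    exact measurable_stateAt_succ lam π s (ih.mono (history_mono lam π s n.le_succ) le_rfl)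
      (measurable_obsAt_history lam π s n.lt_succ_self)

variable [Fintype A] [Fintype W]

lemma measurable_obsAt {n : ℕ} (h : Measurable (stateAt lam π s n)) :
    Measurable (obsAt lam π s n) :=
  measurable_of_finite_cases (measurableSet_pointAt lam π s h) (measurable_obs lam n)

lemma measurable_stateAt (n : ℕ) : Measurable (stateAt lam π s n) := by
  induction n with
  | zero => exact measurable_const
  | succ n ih => exact measurable_stateAt_succ lam π s ih (measurable_obsAt lam π s ih)

lemma history_le (n : ℕ) :
    history lam π s n ≤ (inferInstance : MeasurableSpace (Outcome A W)) :=
  iSup_le fun i => sup_le (comap_pointAt_le lam π s (measurable_stateAt lam π s i))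
    (measurable_obsAt lam π s (measurable_stateAt lam π s i)).comap_le

/-- The histories form a filtration. -/
def historyFiltration : Filtration ℕ (inferInstance : MeasurableSpace (Outcome A W)) where
  seq := history lam π s
  mono' := history_mono lam π s
  le' := history_le lam π s

variable {lam s} in
lemma isGP_stateAt [DecidableEq A] [DecidableEq W] (hlam : ∀ u, 0 ≤ lam u) (hs : IsGP s) (n : ℕ)
    (ω : Outcome A W) : IsGP (stateAt lam π s n ω) := by
  induction n with
  | zero => exact hs
  | succ n ih => exact ih.update hlam _ _

end

/-! ### Open-loop policies -/

/-- Version of `indepFun_prodMk_of_indepFun` for sigma-algebras. -/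
lemma indep_sup_of_indep {Ω : Type*} {m₁ m₂ m₃ m₀ : MeasurableSpace Ω} {P : Measure Ω}
    [IsProbabilityMeasure P] (h₁ : m₁ ≤ m₀) (h₂ : m₂ ≤ m₀) (h₃ : m₃ ≤ m₀)
    (h : Indep m₁ (m₂ ⊔ m₃) P) (h' : Indep m₂ m₃ P) : Indep (m₁ ⊔ m₂) m₃ P := by
  have hcomap : ∀ m m' : MeasurableSpace Ω,
      (m.prod m').comap (fun ω : Ω => ((ω, ω) : Ω × Ω)) = m ⊔ m' := by
    intro m m'
    rw [MeasurableSpace.prod, MeasurableSpace.comap_sup, MeasurableSpace.comap_comp,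
      MeasurableSpace.comap_comp]
    exact congrArg₂ _ MeasurableSpace.comap_id MeasurableSpace.comap_id
  have key : Indep (m₁.comap fun ω => ω) ((m₂.prod m₃).comap fun ω => (ω, ω)) P →
      Indep (m₂.comap fun ω => ω) (m₃.comap fun ω => ω) P →
      Indep ((m₁.prod m₂).comap fun ω => (ω, ω)) (m₃.comap fun ω => ω) P :=
    @indepFun_prodMk_of_indepFun Ω Ω Ω Ω m₀ m₁ m₂ m₃ P _ (fun ω => ω) (fun ω => ω)
    (fun ω => ω) (measurable_id'' h₁) (measurable_id'' h₂) (measurable_id'' h₃)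
  have hid : ∀ m : MeasurableSpace Ω, m.comap (fun ω => ω) = m := fun m =>
    MeasurableSpace.comap_id
  rw [hcomap, hcomap, hid, hid, hid] at key
  exact key h h'

section

variable {A W : Type*}

/-- The policy which evaluates the points of a fixed sequence, whatever is observed. -/
def openLoop (w : ℕ → A × W) : Policy A W where
  act n _ := w n
  measurableSet_act _ _ := MeasurableSet.const _

lemma openLoop_kernel_eq (lam : A × W → ℝ) (w : ℕ → A × W) (s : State A W) (n : ℕ)
    (ω ω' : Outcome A W) :
    (stateAt lam (openLoop w) s n ω).2 = (stateAt lam (openLoop w) s n ω').2 := by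
  induction n with
  | zero => rfl
  | succ n ih =>
    simp only [stateAt, update, ih]
    rfl

/-- The residual `F v - μₙ v` of the process after `n` evaluations. -/
def residual (lam : A × W → ℝ) (π : Policy A W) (s : State A W) (n : ℕ) (v : A × W)
    (ω : Outcome A W) : ℝ :=
  ω.1 v - (stateAt lam π s n ω).1 v

variable [Fintype A] [Fintype W] [DecidableEq A] [DecidableEq W]

/-- Along a fixed sequence of points, the residual of `F` is independent of the observations, and
it is a centered Gaussian vector whose covariance kernel is the (deterministic) kernel of the
state. -/
theorem openLoop_residual {lam : A × W → ℝ} (hlam : ∀ u, 0 ≤ lam u) {s : State A W} (hs : IsGP s)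
    (w : ℕ → A × W) (n : ℕ) :
    HasGaussianLaw (fun ω v => residual lam (openLoop w) s n v ω) (law s) ∧
    (∀ v, ∫ ω, residual lam (openLoop w) s n v ω ∂(law s) = 0) ∧
    (∀ ω₀ v v', cov[residual lam (openLoop w) s n v, residual lam (openLoop w) s n v'; law s]
      = (stateAt lam (openLoop w) s n ω₀).2 v v') ∧
    Indep (MeasurableSpace.comap (fun ω v => residual lam (openLoop w) s n v ω) inferInstance)
      (history lam (openLoop w) s n) (law s) := by
  induction n with
  | zero =>
    refine ⟨hasGaussianLaw_centered s, integral_centered s, fun _ => covariance_centered hs, ?_⟩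
    have : history lam (openLoop w) s 0 = ⊥ := iSup_of_empty _
    rw [this]
    exact indep_bot_right _
  | succ n ih =>
    obtain ⟨hG, h0, hcov, hind⟩ := ih
    set R : A × W → Outcome A W → ℝ := residual lam (openLoop w) s n with hR
    set R' : A × W → Outcome A W → ℝ := residual lam (openLoop w) s (n + 1) with hR'
    let ω₁ : Outcome A W := 0
    set K := (stateAt lam (openLoop w) s n ω₁).2 with hK
    set u := w n with hu
    let inn : Outcome A W → ℝ := fun ω => R u ω + √(lam u) * ω.2 n
    have hH := history_le lam (openLoop w) s n
    have hRm : Measurable fun ω v => R v ω := by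
      have := measurable_stateAt lam (openLoop w) s n
      unfold R residual
      fun_prop
    have hem : Measurable fun ω : Outcome A W => ω.2 n := by fun_prop
    -- the noise at stage `n` is independent of the residual and of the history
    have hpast :
        MeasurableSpace.comap (fun ω v => R v ω) inferInstance ⊔ history lam (openLoop w) s n ≤
        MeasurableSpace.comap (fun ω : Outcome A W => (ω.1, fun i : Finset.range n => ω.2 i))
          inferInstance := by
      set G := MeasurableSpace.comap
        (fun ω : Outcome A W => (ω.1, fun i : Finset.range n => ω.2 i)) inferInstance with hGdef
      have hcomp : Measurable[G]
        (fun ω : Outcome A W => (ω.1, fun i : Finset.range n => ω.2 i)) := comap_measurable _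
      have hHG : history lam (openLoop w) s n ≤ G := by
        refine iSup_le fun i => sup_le ?_ ?_
        · have : pointAt lam (openLoop w) s i = fun _ => w i := rfl
          rw [this, MeasurableSpace.comap_const]
          exact bot_le
        · have hi : Measurable fun q : EuclideanSpace ℝ (A × W) × (Finset.range n → ℝ) =>
              q.1 (w i) + √(lam (w i)) * q.2 ⟨i, Finset.mem_range.2 i.2⟩ := by fun_prop
          exact (hi.comp hcomp).comap_le
      refine sup_le ?_ hHG
      refine Measurable.comap_le ?_
      have hst := (measurable_stateAt_history lam (openLoop w) s n).mono hHG le_rfl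
      refine measurable_pi_lambda _ fun v => Measurable.sub ?_ ?_
      · have hi : Measurable fun q : EuclideanSpace ℝ (A × W) × (Finset.range n → ℝ) =>
              q.1 v := by fun_prop
        exact hi.comp hcomp
      · exact (measurable_pi_apply v).comp (measurable_fst.comp hst)
    have hnoise : Indep (MeasurableSpace.comap (fun ω : Outcome A W => ω.2 n) inferInstance)
        (MeasurableSpace.comap (fun ω v => R v ω) inferInstance ⊔ history lam (openLoop w) s n)
        (law s) :=
      (indep_of_indep_of_le_left ((IndepFun_iff_Indep _ _ _).1 (indepFun_noise s n)) hpast).symm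
    have hjoint := indep_sup_of_indep hem.comap_le hRm.comap_le hH hnoise hind
    have hRe : IndepFun (fun ω v => R v ω) (fun ω : Outcome A W => ω.2 n) (law s) :=
      (indep_of_indep_of_le_right hnoise le_sup_left).symm
    obtain ⟨h1, h2, h3, h4, -, -, -⟩ := gaussian_residual hG (hasGaussianLaw_noise s n) hRe h0
      (integral_noise s n) (covariance_noise s n) (hcov ω₁) u (Real.sq_sqrt (hlam u))
      ((isGP_stateAt (openLoop w) hlam hs n ω₁).degenerate hlam u)
    have hstep : ∀ v ω, R' v ω = R v ω - K v u / (K u u + lam u) * inn ω := by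
      intro v ω
      have hKω : (stateAt lam (openLoop w) s n ω).2 = K := openLoop_kernel_eq lam w s n ω ω₁
      change ω.1 v - ((stateAt lam (openLoop w) s n ω).1 v +
        (stateAt lam (openLoop w) s n ω).2 v u / ((stateAt lam (openLoop w) s n ω).2 u u + lam u)
          * (ω.1 u + √(lam u) * ω.2 n - (stateAt lam (openLoop w) s n ω).1 u)) =
        ω.1 v - (stateAt lam (openLoop w) s n ω).1 v - K v u / (K u u + lam u) *
          (ω.1 u - (stateAt lam (openLoop w) s n ω).1 u + √(lam u) * ω.2 n)
      rw [hKω]; ring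
    have hstep' : ∀ v, R' v = fun ω => R v ω - K v u / (K u u + lam u) * inn ω := fun v =>
      funext (hstep v)
    have hstep'' : (fun ω v => R' v ω) = fun ω v => R v ω - K v u / (K u u + lam u) * inn ω :=
      funext fun ω => funext fun v => hstep v ω
    have hmeas : ∀ m : MeasurableSpace (Outcome A W),
        MeasurableSpace.comap (fun ω : Outcome A W => ω.2 n) inferInstance ≤ m →
        MeasurableSpace.comap (fun ω v => R v ω) inferInstance ≤ m →
        Measurable[m] inn ∧ Measurable[m] (fun ω v => R' v ω) := by
      intro m hm₁ hm₂
      have hRv : ∀ v, Measurable[m] (R v) := fun v =>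
        (measurable_pi_apply v).comp ((comap_measurable (fun ω v => R v ω)).mono hm₂ le_rfl)
      have hi : Measurable[m] inn := (hRv u).add (Measurable.const_mul
        ((comap_measurable (fun ω : Outcome A W => ω.2 n)).mono hm₁ le_rfl) _)
      refine ⟨hi, ?_⟩
      rw [hstep'']
      exact measurable_pi_lambda _ fun v => (hRv v).sub (hi.const_mul _)
    obtain ⟨hinn, hR'm⟩ := hmeas _ le_sup_left le_sup_right
    have hle := sup_le hem.comap_le hRm.comap_le
    refine ⟨?_, fun v => ?_, fun ω₀ v v' => ?_, ?_⟩
    · rw [hstep'']; exact h1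
    · rw [hstep']; exact h2 v
    · rw [hstep', hstep', h3, openLoop_kernel_eq lam w s (n + 1) ω₀ ω₁]
      rfl
    · have h5 : Indep (history lam (openLoop w) s n) (MeasurableSpace.comap inn inferInstance ⊔
          MeasurableSpace.comap (fun ω v => R' v ω) inferInstance) (law s) :=
        (indep_of_indep_of_le_left hjoint (sup_le hinn.comap_le hR'm.comap_le)).symm
      have h6 : Indep (MeasurableSpace.comap inn inferInstance)
          (MeasurableSpace.comap (fun ω v => R' v ω) inferInstance) (law s) := by
        rw [hstep'']; exact h4.symm
      have h7 := indep_sup_of_indep hH (hinn.mono hle le_rfl).comap_le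
        (hR'm.mono hle le_rfl).comap_le h5 h6
      refine indep_of_indep_of_le_right h7.symm ?_
      rw [history_succ]
      refine sup_le le_sup_left (sup_le ?_ ?_)
      · have : pointAt lam (openLoop w) s n = fun _ => w n := rfl
        rw [this, MeasurableSpace.comap_const]
        exact bot_le
      · -- the observation is the sum of the innovation and of the posterior mean at `u`
        refine Measurable.comap_le ?_
        have hobs : obsAt lam (openLoop w) s n
            = fun ω => inn ω + (stateAt lam (openLoop w) s n ω).1 u := by
          funext ω
          change ω.1 u + √(lam u) * ω.2 n = ω.1 u - (stateAt lam (openLoop w) s n ω).1 u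
            + √(lam u) * ω.2 n + (stateAt lam (openLoop w) s n ω).1 u
          ring
        rw [hobs]
        exact ((comap_measurable inn).mono le_sup_right le_rfl).add ((measurable_pi_apply u).comp
          (measurable_fst.comp
            ((measurable_stateAt_history lam (openLoop w) s n).mono le_sup_left le_rfl)))

end

/-! ### From open-loop policies to adaptive policies -/

/-- The event that the first `n` evaluated points are `w 0, …, w (n - 1)`. -/
def pathEvent {A W : Type*} (lam : A × W → ℝ) (π : Policy A W) (s : State A W) (n : ℕ)
    (w : ℕ → A × W) : Set (Outcome A W) :=
  {ω | ∀ i < n, pointAt lam π s i ω = w i}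

/-- If two sigma-algebras have the same trace on a common set `B`, then they have the same
measurable subsets of `B`. -/
lemma measurableSet_inter_of_comap_eq {Ω : Type*} {m m' : MeasurableSpace Ω} {B : Set Ω}
    (hB : MeasurableSet[m'] B)
    (h : m.comap (Subtype.val : B → Ω) = m'.comap Subtype.val) {t : Set Ω}
    (ht : MeasurableSet[m] (B ∩ t)) : MeasurableSet[m'] (B ∩ t) := by
  have h1 : MeasurableSet[m'.comap (Subtype.val : B → Ω)] (Subtype.val ⁻¹' (B ∩ t)) := by
    rw [← h]; exact ⟨_, ht, rfl⟩
  obtain ⟨C, hC, hCt⟩ := h1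
  have : B ∩ t = B ∩ C := by
    rw [Subtype.preimage_val_eq_preimage_val_iff] at hCt
    rw [hCt, ← Set.inter_assoc, Set.inter_self]
  rw [this]
  exact hB.inter hC

section

variable {A W : Type*} (lam : A × W → ℝ) (π : Policy A W) (s : State A W)

/-- While the policy follows the path `w`, its states are those of the open-loop policy. -/
lemma stateAt_eq_openLoop (w : ℕ → A × W) {n : ℕ} {ω : Outcome A W}
    (h : ω ∈ pathEvent lam π s n w) :
    stateAt lam π s n ω = stateAt lam (openLoop w) s n ω := by
  induction n with
  | zero => rfl
  | succ n ih =>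
    have h1 := ih fun i hi => h i (hi.trans n.lt_succ_self)
    have h2 : π.act n (stateAt lam π s n ω) = w n := h n n.lt_succ_self
    simp only [stateAt, h2]
    rw [h1]
    rfl

/-- Whether the path `w` is followed can be decided from the states of the open-loop policy. This
makes the event measurable with respect to the open-loop history. -/
lemma mem_pathEvent_iff (w : ℕ → A × W) {n : ℕ} {ω : Outcome A W} :
    ω ∈ pathEvent lam π s n w ↔
      ∀ i < n, π.act i (stateAt lam (openLoop w) s i ω) = w i := by
  constructor
  · intro h i hi
    rw [← stateAt_eq_openLoop lam π s w fun j hj => h j (hj.trans hi)]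
    exact h i hi
  · intro h
    induction n with
    | zero => intro i hi; simp at hi
    | succ n ih =>
      have h1 := ih fun i hi => h i (hi.trans n.lt_succ_self)
      intro i hi
      rcases (Nat.lt_succ_iff.1 hi).lt_or_eq with hi | rfl
      · exact h1 i hi
      · rw [pointAt, stateAt_eq_openLoop lam π s w h1]
        exact h i hi

/-- On the event that the path `w` is followed, the history of the policy has the same trace as the
history of the open-loop policy. -/
lemma comap_history_eq (n : ℕ) (w : ℕ → A × W) :
    (history lam π s n).comap (Subtype.val : pathEvent lam π s n w → Outcome A W)
      = (history lam (openLoop w) s n).comap Subtype.val := by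
  simp only [history, MeasurableSpace.comap_iSup, MeasurableSpace.comap_sup,
    MeasurableSpace.comap_comp]
  refine iSup_congr fun i => ?_
  have h1 : pointAt lam π s i ∘ (Subtype.val : pathEvent lam π s n w → Outcome A W)
      = pointAt lam (openLoop w) s i ∘ Subtype.val := funext fun ω => ω.2 i i.2
  have h2 : obsAt lam π s i ∘ (Subtype.val : pathEvent lam π s n w → Outcome A W)
      = obsAt lam (openLoop w) s i ∘ Subtype.val := by
    funext ω
    have := congrFun h1 ω
    simp only [Function.comp_apply] at this
    simp only [Function.comp_apply, obsAt, this]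
  rw [h1, h2]

/-- Extension of a finite path to a sequence of points. -/
def extendPath [Nonempty A] [Nonempty W] {n : ℕ} (w : Fin n → A × W) (i : ℕ) : A × W :=
  if h : i < n then w ⟨i, h⟩ else Classical.arbitrary _

lemma iUnion_pathEvent [Nonempty A] [Nonempty W] (n : ℕ) :
    ⋃ w : Fin n → A × W, pathEvent lam π s n (extendPath w) = Set.univ := by
  refine Set.eq_univ_of_forall fun ω => Set.mem_iUnion.2
    ⟨fun i => pointAt lam π s i ω, fun i hi => ?_⟩
  simp [extendPath, hi]

lemma pairwise_disjoint_pathEvent [Nonempty A] [Nonempty W] (n : ℕ) :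
    Pairwise (Function.onFun Disjoint
      fun w : Fin n → A × W => pathEvent lam π s n (extendPath w)) := by
  intro w w' hne
  refine Set.disjoint_left.2 fun ω h h' => hne (funext fun i => ?_)
  have h1 := (h i i.2).symm.trans (h' i i.2)
  simpa [extendPath] using h1

variable [Fintype A] [Fintype W]

lemma measurableSet_pathEvent_history (n : ℕ) (w : ℕ → A × W) :
    MeasurableSet[history lam π s n] (pathEvent lam π s n w) := by
  have : pathEvent lam π s n w = ⋂ i ∈ Set.Iio n, {ω | pointAt lam π s i ω = w i} := by
    ext ω; simp [pathEvent]
  rw [this]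
  exact MeasurableSet.biInter (Set.to_countable _) fun i hi => measurableSet_pointAt lam π s
    ((measurable_stateAt_history lam π s i).mono (history_mono lam π s (le_of_lt hi)) le_rfl) _

lemma measurableSet_pathEvent_openLoop (n : ℕ) (w : ℕ → A × W) :
    MeasurableSet[history lam (openLoop w) s n] (pathEvent lam π s n w) := by
  have : pathEvent lam π s n w
      = ⋂ i ∈ Set.Iio n, stateAt lam (openLoop w) s i ⁻¹' {t | π.act i t = w i} := by
    ext ω; simp [mem_pathEvent_iff]
  rw [this]
  exact MeasurableSet.biInter (Set.to_countable _) fun i hi =>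
    ((measurable_stateAt_history lam (openLoop w) s i).mono
      (history_mono lam (openLoop w) s (le_of_lt hi)) le_rfl) (π.measurableSet_act i _)

variable [DecidableEq A] [DecidableEq W]

variable {lam s}

/-- The residual is independent of the open-loop history, so only the mean function of the state
survives in the conditional expectation. -/
lemma openLoop_condExp (hlam : ∀ u, 0 ≤ lam u) (hs : IsGP s) (w : ℕ → A × W) (n : ℕ)
    (v : A × W) :
    (law s)[fun ω => ω.1 v | history lam (openLoop w) s n]
      =ᵐ[law s] fun ω => (stateAt lam (openLoop w) s n ω).1 v := by
  obtain ⟨hG, h0, -, hind⟩ := openLoop_residual hlam hs w n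
  have hH := history_le lam (openLoop w) s n
  have hRi : Integrable (residual lam (openLoop w) s n v) (law s) := (hG.eval v).integrable
  have hm : StronglyMeasurable[history lam (openLoop w) s n]
      fun ω => (stateAt lam (openLoop w) s n ω).1 v :=
    ((measurable_pi_apply v).comp (measurable_fst.comp
      (measurable_stateAt_history lam (openLoop w) s n))).stronglyMeasurable
  have hmi : Integrable (fun ω => (stateAt lam (openLoop w) s n ω).1 v) (law s) :=
    ((integrable_process s v).sub hRi).congr (ae_of_all _ fun ω => by simp [residual])
  have hRm : Measurable fun ω v => residual lam (openLoop w) s n v ω := by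
    have := measurable_stateAt lam (openLoop w) s n
    unfold residual
    fun_prop
  have hR : (law s)[residual lam (openLoop w) s n v | history lam (openLoop w) s n]
      =ᵐ[law s] fun _ => 0 := by
    have := condExp_indep_eq (f := residual lam (openLoop w) s n v) hRm.comap_le hH
      ((measurable_pi_apply v).comp (comap_measurable
        fun ω v => residual lam (openLoop w) s n v ω)).stronglyMeasurable hind
    rwa [h0] at this
  have hsum : (fun ω : Outcome A W => ω.1 v) = residual lam (openLoop w) s n v
      + fun ω => (stateAt lam (openLoop w) s n ω).1 v := by
    funext ω; simp [residual]
  rw [hsum]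
  refine (condExp_add hRi hmi _).trans ?_
  rw [condExp_of_stronglyMeasurable hH hm hmi]
  filter_upwards [hR] with ω hω
  simp [hω]

/-- The square of the residual is independent of the open-loop history, and its mean is given by the
kernel of the state. -/
lemma openLoop_setLIntegral (hlam : ∀ u, 0 ≤ lam u) (hs : IsGP s) (w : ℕ → A × W) (n : ℕ)
    (f : A × W → ℝ) {B : Set (Outcome A W)}
    (hB : MeasurableSet[history lam (openLoop w) s n] B) :
    ∫⁻ ω in B, ENNReal.ofReal ((∑ v, f v * residual lam (openLoop w) s n v ω) ^ 2) ∂(law s)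
      = ∫⁻ ω in B, ENNReal.ofReal (quad (stateAt lam (openLoop w) s n ω).2 f) ∂(law s) := by
  obtain ⟨hG, h0, hcov, hind⟩ := openLoop_residual hlam hs w n
  have hH := history_le lam (openLoop w) s n
  set R := residual lam (openLoop w) s n with hR
  have hRL : ∀ v, MemLp (R v) 2 (law s) := fun v => (hG.eval v).memLp_two
  have hRm : Measurable fun ω v => R v ω := by
    have := measurable_stateAt lam (openLoop w) s n
    unfold R residual
    fun_prop
  let ω₀ : Outcome A W := 0
  have hDL : MemLp (fun ω => ∑ v, f v * R v ω) 2 (law s) :=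
    memLp_finsetSum _ fun v _ => (hRL v).const_mul _
  have hmean : ∫ ω, ∑ v, f v * R v ω ∂(law s) = 0 := by
    rw [integral_finsetSum _ fun v _ => ((hRL v).const_mul _).integrable one_le_two]
    exact Finset.sum_eq_zero fun v _ => by rw [integral_const_mul, h0, mul_zero]
  have hvar : ∫ ω, (∑ v, f v * R v ω) ^ 2 ∂(law s)
      = quad (stateAt lam (openLoop w) s n ω₀).2 f := by
    have h1 : Var[fun ω => ∑ v, f v * R v ω; law s]
        = ∫ ω, (∑ v, f v * R v ω) ^ 2 ∂(law s) :=
      variance_of_integral_eq_zero hDL.aestronglyMeasurable.aemeasurable hmean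
    rw [← h1, ← covariance_self hDL.aestronglyMeasurable.aemeasurable,
      covariance_fun_sum_fun_sum (fun v => (hRL v).const_mul _)
        (fun v => (hRL v).const_mul _), quad]
    refine Finset.sum_congr rfl fun v _ => Finset.sum_congr rfl fun v' _ => ?_
    rw [covariance_const_mul_left, covariance_const_mul_right, hcov ω₀]
    ring
  have hkey := lintegral_mul_indicator_eq_lintegral_mul_lintegral_indicator
    (f := fun ω => ENNReal.ofReal ((∑ v, f v * R v ω) ^ 2)) (μ := law s) hRm.comap_le 1
    (hH _ hB) ?_ ?_
  · have hsq : ∫⁻ ω, ENNReal.ofReal ((∑ v, f v * R v ω) ^ 2) ∂(law s)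
        = ENNReal.ofReal (quad (stateAt lam (openLoop w) s n ω₀).2 f) := by
      rw [← ofReal_integral_eq_lintegral_ofReal hDL.integrable_sq
        (ae_of_all _ fun ω => sq_nonneg _), hvar]
    rw [hsq, lintegral_indicator_const (hH _ hB), one_mul] at hkey
    have hconst : ∀ ω, (stateAt lam (openLoop w) s n ω).2
        = (stateAt lam (openLoop w) s n ω₀).2 := fun ω => openLoop_kernel_eq lam w s n ω ω₀
    simp only [hconst]
    rw [setLIntegral_const, ← hkey, ← lintegral_indicator (hH _ hB)]
    refine lintegral_congr fun ω => ?_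
    by_cases hω : ω ∈ B <;> simp [hω]
  · refine indepSets_of_indepSets_of_le_right (Indep_iff_IndepSets _ _ _ |>.1 hind) ?_
    rintro _ rfl
    exact hB
  · have hm : Measurable fun r : A × W → ℝ => ENNReal.ofReal ((∑ v, f v * r v) ^ 2) := by fun_prop
    exact hm.comp (comap_measurable _)

variable [Nonempty A] [Nonempty W]

/-- The mean function of the state is the posterior mean of the process. On the event that a given
path is followed, the history carries the same information as the history of the open-loop policy
along this path. -/
theorem condExp_process (hlam : ∀ u, 0 ≤ lam u) (hs : IsGP s) (n : ℕ) (v : A × W) :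
    (law s)[fun ω => ω.1 v | history lam π s n]
      =ᵐ[law s] fun ω => (stateAt lam π s n ω).1 v := by
  have key : ∀ w : Fin n → A × W, ∀ᵐ ω ∂(law s), ω ∈ pathEvent lam π s n (extendPath w) →
      ((law s)[fun ω => ω.1 v | history lam π s n]) ω = (stateAt lam π s n ω).1 v := by
    intro w
    set B := pathEvent lam π s n (extendPath w) with hBdef
    have hB := measurableSet_pathEvent_history lam π s n (extendPath w)
    have hB' := measurableSet_pathEvent_openLoop lam π s n (extendPath w)
    have hc := comap_history_eq lam π s n (extendPath w)
    have h1 := condExp_ae_eq_restrict_of_measurableSpace_eq_on (f := fun ω => ω.1 v)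
      (μ := law s) (history_le lam π s n) (history_le lam (openLoop (extendPath w)) s n) hB
      fun t => ⟨measurableSet_inter_of_comap_eq hB' hc, measurableSet_inter_of_comap_eq hB hc.symm⟩
    rw [Filter.EventuallyEq, ae_restrict_iff' (history_le lam π s n _ hB)] at h1
    filter_upwards [h1, openLoop_condExp hlam hs (extendPath w) n v] with ω h2 h3 hω
    rw [h2 hω, h3, stateAt_eq_openLoop lam π s _ hω]
  filter_upwards [ae_all_iff.2 key] with ω hω
  obtain ⟨w, hw⟩ := Set.mem_iUnion.1
    ((iUnion_pathEvent lam π s n).symm ▸ Set.mem_univ ω)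
  exact hω w hw

/-- The kernel of the state gives the mean square errors of the posterior mean. -/
theorem lintegral_residual_sq (hlam : ∀ u, 0 ≤ lam u) (hs : IsGP s) (n : ℕ) (f : A × W → ℝ) :
    ∫⁻ ω, ENNReal.ofReal ((∑ v, f v * residual lam π s n v ω) ^ 2) ∂(law s)
      = ∫⁻ ω, ENNReal.ofReal (quad (stateAt lam π s n ω).2 f) ∂(law s) := by
  have hB := fun w : Fin n → A × W => history_le lam π s n _
    (measurableSet_pathEvent_history lam π s n (extendPath w))
  have hsplit : ∀ g : Outcome A W → ENNReal, ∫⁻ ω, g ω ∂(law s)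
      = ∑' w : Fin n → A × W, ∫⁻ ω in pathEvent lam π s n (extendPath w), g ω ∂(law s) := by
    intro g
    rw [← lintegral_iUnion hB (pairwise_disjoint_pathEvent lam π s n), iUnion_pathEvent,
      setLIntegral_univ]
  rw [hsplit, hsplit]
  refine tsum_congr fun w => ?_
  have h := openLoop_setLIntegral hlam hs (extendPath w) n f
    (measurableSet_pathEvent_openLoop lam π s n (extendPath w))
  refine (setLIntegral_congr_fun (hB w) fun ω hω => ?_).trans
    (h.trans (setLIntegral_congr_fun (hB w) fun ω hω => ?_))
  · simp only [residual, stateAt_eq_openLoop lam π s _ hω]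
  · simp only [stateAt_eq_openLoop lam π s _ hω]

end

/-! ### Convergence of the value -/

lemma integrable_iSup {A Ω : Type*} [Fintype A] [MeasurableSpace Ω] {P : Measure Ω} [Nonempty A]
    {f : A → Ω → ℝ} (hf : ∀ x, Integrable (f x) P) : Integrable (fun ω => ⨆ x, f x ω) P := by
  refine Integrable.mono' (integrable_finsetSum Finset.univ fun x _ => (hf x).abs)
    (AEMeasurable.iSup fun x => (hf x).aemeasurable).aestronglyMeasurable (ae_of_all _ fun ω => ?_)
  have h := abs_iSup_sub_iSup_le (fun x => f x ω) fun _ : A => (0 : ℝ)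
  simpa using h

lemma measurable_quad_stateAt {A W : Type*} [Fintype A] [Fintype W] (lam : A × W → ℝ)
    (π : Policy A W) (s : State A W) (n : ℕ) (f : A × W → ℝ) :
    Measurable fun ω => quad (stateAt lam π s n ω).2 f := by
  have := measurable_stateAt lam π s n
  unfold quad
  fun_prop

section

variable {A W : Type*} [Fintype A] [Fintype W] [DecidableEq A] [DecidableEq W]
  {lam : A × W → ℝ} {s : State A W}

lemma quad_stateAt_le (hlam : ∀ u, 0 ≤ lam u) (hs : IsGP s) (π : Policy A W) (f : A × W → ℝ)
    (n : ℕ) (ω : Outcome A W) : quad (stateAt lam π s n ω).2 f ≤ quad s.2 f := by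
  induction n with
  | zero => exact le_rfl
  | succ n ih =>
    refine le_trans ?_ ih
    rw [stateAt, quad_update]
    exact sub_le_self _ (div_nonneg (sq_nonneg _) (add_nonneg
      ((isGP_stateAt π hlam hs n ω).diag_nonneg _) (hlam _)))

lemma integrable_quad_stateAt (hlam : ∀ u, 0 ≤ lam u) (hs : IsGP s) (π : Policy A W)
    (f : A × W → ℝ) (n : ℕ) :
    Integrable (fun ω => quad (stateAt lam π s n ω).2 f) (law s) := by
  refine Integrable.mono' (integrable_const (quad s.2 f))
    (measurable_quad_stateAt lam π s n f).aestronglyMeasurable (ae_of_all _ fun ω => ?_)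
  rw [Real.norm_of_nonneg ((isGP_stateAt π hlam hs n ω).quad_nonneg f)]
  exact quad_stateAt_le hlam hs π f n ω

lemma integrable_objective (p : W → ℝ) (s : State A W) (x : A) :
    Integrable (objective p x) (law s) :=
  integrable_finsetSum _ fun w _ => (integrable_process s (x, w)).mul_const _

/-- No policy does better than full information about `F`. -/
lemma value_le [Nonempty A] (p : W → ℝ) (lam : A × W → ℝ) (π : Policy A W) (s : State A W) (n : ℕ) :
    value p lam π s n ≤ expMaxObjective p s := by
  have hi := integrable_iSup fun x => integrable_objective p s x
  rw [expMaxObjective, ← integral_condExp (history_le lam π s n)]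
  refine integral_mono_ae (integrable_iSup fun x => integrable_condExp) integrable_condExp ?_
  have h : ∀ x, postMean p lam π s n x
      ≤ᵐ[law s] (law s)[fun ω => ⨆ x, objective p x ω | history lam π s n] := fun x =>
    condExp_mono (integrable_objective p s x) hi
      (ae_of_all _ fun ω => le_ciSup (Set.finite_range fun x => objective p x ω).bddAbove x)
  filter_upwards [ae_all_iff.2 h] with ω hω
  exact ciSup_le hω

variable [Nonempty A] [Nonempty W]

lemma integrable_stateAt_mean (hlam : ∀ u, 0 ≤ lam u) (hs : IsGP s) (π : Policy A W) (n : ℕ)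
    (v : A × W) : Integrable (fun ω => (stateAt lam π s n ω).1 v) (law s) :=
  integrable_condExp.congr (condExp_process π hlam hs n v)

/-- The posterior mean of `G x` is the linear functional `meanG` of the state. -/
lemma postMean_ae_eq (p : W → ℝ) (hlam : ∀ u, 0 ≤ lam u) (hs : IsGP s) (π : Policy A W) (n : ℕ)
    (x : A) :
    postMean p lam π s n x =ᵐ[law s] fun ω => meanG p (stateAt lam π s n ω) x := by
  have hobj : objective p x = ∑ w, p w • fun ω : Outcome A W => ω.1 (x, w) := by
    funext ω
    simp [objective, Finset.sum_apply, mul_comm]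
  rw [postMean, hobj]
  refine (condExp_finsetSum (fun w _ => (integrable_process s (x, w)).smul (p w)) _).trans ?_
  have h : ∀ w, (law s)[p w • fun ω : Outcome A W => ω.1 (x, w) | history lam π s n]
      =ᵐ[law s] fun ω => p w * (stateAt lam π s n ω).1 (x, w) := by
    intro w
    refine (condExp_smul (p w) (fun ω : Outcome A W => ω.1 (x, w)) _).trans ?_
    filter_upwards [condExp_process π hlam hs n (x, w)] with ω hω
    simp [hω]
  filter_upwards [ae_all_iff.2 h] with ω hω
  rw [Finset.sum_apply, meanG]
  exact Finset.sum_congr rfl fun w _ => by rw [hω w, mul_comm]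

lemma value_eq (p : W → ℝ) (hlam : ∀ u, 0 ≤ lam u) (hs : IsGP s) (π : Policy A W) (n : ℕ) :
    value p lam π s n = ∫ ω, (⨆ x, meanG p (stateAt lam π s n ω) x) ∂(law s) := by
  refine integral_congr_ae ?_
  filter_upwards [ae_all_iff.2 fun x => postMean_ae_eq p hlam hs π n x] with ω hω
  simp only [hω]

/-- The `L¹` error of the posterior mean is at most the `L²` error, which the kernel determines. -/
lemma integral_abs_contrast_le (hlam : ∀ u, 0 ≤ lam u) (hs : IsGP s) (π : Policy A W) (n : ℕ)
    (f : A × W → ℝ) :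
    ∫ ω, |∑ v, f v * residual lam π s n v ω| ∂(law s)
      ≤ √(∫ ω, quad (stateAt lam π s n ω).2 f ∂(law s)) := by
  set D : Outcome A W → ℝ := fun ω => ∑ v, f v * residual lam π s n v ω
  have hDm : Measurable D := by
    have := measurable_stateAt lam π s n
    unfold D residual
    fun_prop
  have hq0 : ∀ ω, 0 ≤ quad (stateAt lam π s n ω).2 f := fun ω =>
    (isGP_stateAt π hlam hs n ω).quad_nonneg f
  have hlin : ∫⁻ ω, ENNReal.ofReal (D ω ^ 2) ∂(law s)
      = ENNReal.ofReal (∫ ω, quad (stateAt lam π s n ω).2 f ∂(law s)) := by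
    rw [lintegral_residual_sq π hlam hs, ofReal_integral_eq_lintegral_ofReal
      (integrable_quad_stateAt hlam hs π f n) (ae_of_all _ hq0)]
  have hsq : Integrable (fun ω => D ω ^ 2) (law s) := by
    refine ⟨(hDm.pow_const 2).aestronglyMeasurable, ?_⟩
    rw [hasFiniteIntegral_iff_ofReal (ae_of_all _ fun ω => sq_nonneg _), hlin]
    exact ENNReal.ofReal_lt_top
  have hint : ∫ ω, D ω ^ 2 ∂(law s) = ∫ ω, quad (stateAt lam π s n ω).2 f ∂(law s) := by
    rw [integral_eq_lintegral_of_nonneg_ae (ae_of_all _ fun ω => sq_nonneg _)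
      hsq.aestronglyMeasurable, hlin, ENNReal.toReal_ofReal (integral_nonneg hq0)]
  have hDL : MemLp D 2 (law s) := (memLp_two_iff_integrable_sq hDm.aestronglyMeasurable).2 hsq
  refine Real.le_sqrt_of_sq_le ?_
  have hv := variance_nonneg |D| (law s)
  rw [variance_eq_sub hDL.abs] at hv
  simp only [Pi.pow_apply, Pi.abs_apply, sq_abs] at hv
  linarith

/-- The loss of `π` against full information is controlled by the posterior variances of the
differences `G x - G x₀`: the expected errors of the posterior means cancel. -/
lemma abs_value_sub_expMaxObjective_le (p : W → ℝ) (hlam : ∀ u, 0 ≤ lam u) (hs : IsGP s)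
    (π : Policy A W) (n : ℕ) (x₀ : A) :
    |value p lam π s n - expMaxObjective p s|
      ≤ ∑ x, √(∫ ω, quad (stateAt lam π s n ω).2 (contrast p x x₀) ∂(law s)) := by
  have hG := fun x => integrable_objective p s x
  have ha : ∀ x, Integrable (fun ω => meanG p (stateAt lam π s n ω) x) (law s) := fun x =>
    integrable_finsetSum _ fun w _ => (integrable_stateAt_mean hlam hs π n (x, w)).mul_const _
  have hres : ∀ x ω, ∑ v, contrast p x x₀ v * residual lam π s n v ω
      = (objective p x ω - meanG p (stateAt lam π s n ω) x)
        - (objective p x₀ ω - meanG p (stateAt lam π s n ω) x₀) := by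
    intro x ω
    rw [sum_contrast_mul p x x₀ fun v => residual lam π s n v ω]
    simp only [residual, objective, meanG, sub_mul, Finset.sum_sub_distrib]
  have hmean : ∫ ω, (objective p x₀ ω - meanG p (stateAt lam π s n ω) x₀) ∂(law s) = 0 := by
    rw [integral_sub (hG x₀) (ha x₀), ← integral_congr_ae (postMean_ae_eq p hlam hs π n x₀),
      postMean, integral_condExp (history_le lam π s n), sub_self]
  have hi₁ : Integrable (fun ω => (⨆ x, meanG p (stateAt lam π s n ω) x) - ⨆ x, objective p x ω)
      (law s) := (integrable_iSup ha).sub (integrable_iSup hG)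
  have hi₂ : Integrable (fun ω => objective p x₀ ω - meanG p (stateAt lam π s n ω) x₀) (law s) :=
    (hG x₀).sub (ha x₀)
  have hdiff : value p lam π s n - expMaxObjective p s
      = ∫ ω, ((⨆ x, meanG p (stateAt lam π s n ω) x) - (⨆ x, objective p x ω)
        + (objective p x₀ ω - meanG p (stateAt lam π s n ω) x₀)) ∂(law s) := by
    rw [integral_add hi₁ hi₂, hmean,
      integral_sub (integrable_iSup ha) (integrable_iSup hG), value_eq p hlam hs, expMaxObjective,
      add_zero]
  have hD : ∀ x, Integrable
      (fun ω => |∑ v, contrast p x x₀ v * residual lam π s n v ω|) (law s) := by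
    intro x
    simp only [hres]
    exact (((hG x).sub (ha x)).sub ((hG x₀).sub (ha x₀))).abs
  rw [hdiff]
  refine abs_integral_le_integral_abs.trans
    (le_trans ?_ (Finset.sum_le_sum fun x _ => integral_abs_contrast_le hlam hs π n _))
  rw [← integral_finsetSum _ fun x _ => hD x]
  refine integral_mono (hi₁.add hi₂).abs (integrable_finsetSum _ fun x _ => hD x) fun ω => ?_
  dsimp only
  set t := objective p x₀ ω - meanG p (stateAt lam π s n ω) x₀
  have hshift : (⨆ x, (meanG p (stateAt lam π s n ω) x + t))
      = (⨆ x, meanG p (stateAt lam π s n ω) x) + t :=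
    ((OrderIso.addRight t).map_ciSup (Set.finite_range _).bddAbove).symm
  have h := abs_iSup_sub_iSup_le (fun x => meanG p (stateAt lam π s n ω) x + t)
    fun x => objective p x ω
  rw [hshift, add_sub_right_comm] at h
  refine h.trans (le_of_eq (Finset.sum_congr rfl fun x _ => ?_))
  rw [hres, abs_sub_comm]
  congr 1
  ring

/-- The value of a BQO policy converges to the expected maximum under full information. -/
theorem tendsto_value (p : W → ℝ) (hlam : ∀ u, 0 ≤ lam u) (hs : IsGP s) {π : Policy A W}
    (hπ : π.IsBQO p lam) :
    Tendsto (fun N => value p lam π s N) atTop (𝓝 (expMaxObjective p s)) := by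
  -- the posterior means converge, by Lévy's upward theorem
  have hconv : ∀ᵐ ω ∂(law s), ∀ v, ∃ m, Tendsto (fun n => (stateAt lam π s n ω).1 v) atTop (𝓝 m) :=
    ae_all_iff.2 fun v => by
      filter_upwards [tendsto_ae_condExp (ℱ := historyFiltration lam π s)
        (fun ω : Outcome A W => ω.1 v), ae_all_iff.2 fun n => condExp_process π hlam hs n v]
        with ω h1 h2
      exact ⟨_, h1.congr h2⟩
  have hquad : ∀ x x₀ : A, Tendsto
      (fun n => ∫ ω, quad (stateAt lam π s n ω).2 (contrast p x x₀) ∂(law s)) atTop (𝓝 0) := by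
    intro x x₀
    have h := tendsto_integral_of_dominated_convergence (μ := law s)
      (F := fun n ω => quad (stateAt lam π s n ω).2 (contrast p x x₀)) (f := fun _ => 0)
      (fun _ => quad s.2 (contrast p x x₀))
      (fun n => (measurable_quad_stateAt lam π s n _).aestronglyMeasurable) (integrable_const _)
      (fun n => ae_of_all _ fun ω => by
        rw [Real.norm_of_nonneg ((isGP_stateAt π hlam hs n ω).quad_nonneg _)]
        exact quad_stateAt_le hlam hs π _ n ω) ?_
    · simpa using h
    filter_upwards [hconv] with ω hω
    choose m hm using hω
    refine tendsto_quad_contrast_zero p hlam (S := fun n => stateAt lam π s n ω)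
      (fun n => isGP_stateAt π hlam hs n ω) (fun n => rfl) hm (fun n v => ?_) x x₀
    rw [← voi_eq_gain p hlam (isGP_stateAt π hlam hs n ω),
      ← voi_eq_gain p hlam (isGP_stateAt π hlam hs n ω)]
    exact hπ n _ (isGP_stateAt π hlam hs n ω) v
  obtain ⟨x₀⟩ := ‹Nonempty A›
  rw [tendsto_iff_dist_tendsto_zero]
  refine squeeze_zero (fun _ => dist_nonneg)
    (fun n => abs_value_sub_expMaxObjective_le p hlam hs π n x₀) ?_
  have := tendsto_finsetSum Finset.univ fun x _ => (hquad x x₀).sqrt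
  simpa using this

end

end BQO

end

theorem theorem2 {A W : Type*} [Fintype A] [Fintype W] [DecidableEq A] [DecidableEq W]
    [Nonempty A] [Nonempty W]
    (p : W → ℝ) (lam : A × W → ℝ) (hlam : ∀ u, 0 ≤ lam u)
    (π : BQO.Policy A W) (hπ : π.IsBQO p lam)
    (s : BQO.State A W) (hs : BQO.IsGP s) :
    Tendsto (fun N => BQO.value p lam π s N) atTop (𝓝 (BQO.expMaxObjective p s)) ∧
    ∃ L : ℝ,
      Tendsto (fun N => BQO.optValue p lam s N) atTop (𝓝 (L : EReal)) ∧
      Tendsto (fun N => BQO.value p lam π s N) atTop (𝓝 L) := by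
  have h := BQO.tendsto_value p hlam hs hπ
  refine ⟨h, _, ?_, h⟩
  exact tendsto_of_tendsto_of_tendsto_of_le_of_le
    ((continuous_coe_real_ereal.tendsto _).comp h) tendsto_const_nhds
    (fun N => le_iSup (fun π : BQO.Policy A W => (BQO.value p lam π s N : EReal)) π)
    (fun N => iSup_le fun π => EReal.coe_le_coe_iff.2 (BQO.value_le p lam π s N))
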